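/- **Setting.** A *neural network* (NN) $\Phi=((A_1,b_1,\varrho_1),\dots,(A_L,b_L,\varrho_L))$ has weights $A_\ell\in\mathbb R^{N_\ell\times N_{\ell-1}}$, biases $b_\ell\in\mathbb R^{N_\ell}$ and lists $\varrho_\ell$ of $N_\ell$ activation functions, with $\varrho_L=\mathrm{Id}$. Its realization is $\mathrm R(\Phi)(x)=x_L$ with $x_0=x$, $x_\ell=\varrho_\ell(A_\ell x_{\ell-1}+b_\ell)$; its depth is $L(\Phi)=L$ and its size $M(\Phi)$ is the number of nonzero entries of all $A_\ell,b_\ell$. The activations of the hidden layers $\ell<L$ are ReLU, $\rho(x)=\max\{0,x\}$, and BiSU, $\sigma(x)=1$ for $x>0$, $\sigma(x)=0$ for $x\le 0$. Let $\mathrm D\subset\mathbb R^d$, $d\ge2$, be a bounded polytopal domain (open, connected, $\mathrm D=\operatorname{int}\overline{\mathrm D}$) and $\mathcal T$ a regular simplicial triangulation: a finite set of closed $d$-simplices with union $\overline{\mathrm D}$, any two distinct ones being disjoint or meeting in a common subsimplex. Let $\mathcal V,\mathcal E,\mathcal F$ be the sets of its vertices, edges and $(d-1)$-dimensional faces, and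 for a subsimplex $j$ let $s(j)=\#\{K\in\mathcal T: j\subset K\}$. Let $\mathrm S_1$ be the space of continuous functions on $\overline{\mathrm D}$ that are affine on each $K\in\mathcal T$; $\mathrm N_0$ the space of fields with $v|_K(x)=a_K+B_Kx$, $B_K^\top=-B_K$, whose tangential components agree on the common subsimplices of elements; $\mathrm{RT}_0$ the space of fields with $v|_K(x)=a_K+\beta_Kx$, $\beta_K\in\mathbb R$, whose normal components agree on common faces. Fields are identified if they agree a.e. in $\mathrm D$. Intersection with $H^1_0(\mathrm D)$, $H_0(\operatorname{curl};\mathrm D)$ or $L^2(I;H^1_0(\mathrm G))$ means zero values on $\partial\mathrm D$, zero tangential components on $\partial\mathrm D$, zero values on $\overline I\times\partial\mathrm G$, respectively. With barycentric coordinates $\lambda^K_a$ of $K$, the shape functions are, on each $K\in\mathcal T$ that contains the subsimplex (and zero on the other elements): $\lambda^K_a$ for a vertex $a$ ($\mathrm S_1$); $c_e(\lambda^K_a\nabla\lambda^K_b-\lambda^K_b\nabla\lambda^K_a)$ for an edge $e$ with endpoints $a,b$ ($\mathrm N_0$); and, for a face $f$ opposite to the vertex $a$ of $K$, the multiple of $x\mapsto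 x-a$ whose scalar product with $n_f$ is $1$ on $f$ ($\mathrm{RT}_0$). Here the orientations of the edges, the constants $c_e\ne0$ and the nonzero normal vectors $n_f$ are arbitrary but fixed. Consider the product spaces $\blacklozenge=\blacklozenge_1\times\dots\times\blacklozenge_m$ with index sets $\mathcal I=\bigcup_k\mathcal I_k\times\{k\}$: 1. $\mathbb V^{(1)}=(\mathrm S_1\cap H^1_0(\mathrm D))\times\mathrm{RT}_0$, $\mathcal I_1=\mathcal V\cap\mathrm D$, $\mathcal I_2=\mathcal F$; 2. $\mathbb V^{(2)}=(\mathrm S_1\cap H^1_0(\mathrm D))^d\times\mathrm{RT}_0^d$, $\mathcal I_1=\dots=\mathcal I_d=\mathcal V\cap\mathrm D$, $\mathcal I_{d+1}=\dots=\mathcal I_{2d}=\mathcal F$; 3. for $d\le3$: $\mathbb V^{(3)}=(\mathrm N_0\cap H_0(\operatorname{curl};\mathrm D))\times\mathrm N_0$, $\mathcal I_1=\{e\in\mathcal E:e\cap\mathrm D\ne\emptyset\}$, $\mathcal I_2=\mathcal E$; 4. on a cylinder $\mathrm D=I\times\mathrm G$ with $I=(0,\tau)$, $\tau>0$, and a bounded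 polytopal domain $\mathrm G\subset\mathbb R^d$, where now $d\ge1$ and $\mathcal T$ is a triangulation of $\mathrm D\subset\mathbb R^{1+d}$: $\mathbb V^{(4)}=(\mathrm S_1\cap L^2(I;H^1_0(\mathrm G)))\times\mathrm S_1^d$, $\mathcal I_1=\mathcal V\cap(\overline I\times\mathrm G)$, $\mathcal I_2=\dots=\mathcal I_{d+1}=\mathcal V$. For $i=(j,k)\in\mathcal I$ let $\theta_i$ be the shape function of $\blacklozenge_k$ that belongs to $j$, $s(i)=s(j)$, and $\mathfrak s(\mathcal I)=\max_{i\in\mathcal I}s(i)$. **Proposition.** There is a constant $C>0$, independent of $d$, $\mathrm D$ and $\mathcal T$, such that for each of these spaces $\blacklozenge$ and every $\mathcal T$ the following holds. We have $\dim\blacklozenge=|\mathcal I|$, and every $v\in\blacklozenge$ has unique coefficients $(v_i)_{i\in\mathcal I}$ with $v_{(k)}=\sum_{i=(j,k)\in\mathcal I}v_i\theta_i$ for $k=1,\dots,m$. There is a NN $\Phi^{\blacklozenge}$ with ReLU and BiSU activations such that $\mathrm R(\Phi^\blacklozenge)(x)_i=\theta_i(x)$ for a.e. $x\in\mathrm D$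 and all $i\in\mathcal I$, and $$L(\Phi^\blacklozenge)=5,\qquad M(\Phi^\blacklozenge)\le Cd^2\sum_{i\in\mathcal I}s(i)\le Cd^2\,\mathfrak s(\mathcal I)\dim\blacklozenge .$$ For every $v=(v_{(1)},\dots,v_{(m)})\in\blacklozenge$ there is a NN $\Phi^{\blacklozenge,v}$ with ReLU and BiSU activations and with the same hidden layers as $\Phi^\blacklozenge$ such that $\mathrm R(\Phi^{\blacklozenge,v})_k=v_{(k)}$ a.e. in $\mathrm D$ for $k=1,\dots,m$, and $$L(\Phi^{\blacklozenge,v})=5,\qquad M(\Phi^{\blacklozenge,v})\le Cd^2\sum_{i\in\mathcal I}s(i)\le Cd^2\,\mathfrak s(\mathcal I)\dim\blacklozenge .$$ For each of the four families, the layer dimensions and the lists of activation functions of these NNs do not depend on $v$, and depend on $\mathcal T$ only through the dimension $d$ and the family $(s(i))_{i\in\mathcal I}$ (hence also $|\mathcal I|$). The set $\mathcal{NN}=\{\Phi^{\blacklozenge,v}:v\in\blacklozenge\}$ with the linear operation $\Phi^{\blacklozenge,v}\,\widehat+\,\lambda\Phi^{\blacklozenge,w}:=\Phi^{\blacklozenge,v+\lambda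 w}$ is a vector space, and $\mathrm R:\mathcal{NN}\to\blacklozenge$ is a linear isomorphism. -/

import Mathlib

open MeasureTheory
open scoped Matrix

noncomputable section

namespace Fosls

/-! ### Neural networks with ReLU and BiSU activations -/

/-- The two activation functions that are used. -/
inductive Activation : Type
  | relu : Activation
  | bisu : Activation

/-- `ρ(x) = max {0, x}`, and `σ(x) = 1` for `x > 0`, `σ(x) = 0` for `x ≤ 0`. -/
def Activation.toFun : Activation → ℝ → ℝ
  | .relu, x => max 0 x
  | .bisu, x => if 0 < x then 1 else 0

/-- A finite sequence of hidden layers `(A_ℓ, b_ℓ, ϱ_ℓ)` that maps `ℝ^n` to `ℝ^m`; every node has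
its own activation function. -/
inductive HiddenLayers : ℕ → ℕ → Type
  | nil (n : ℕ) : HiddenLayers n n
  | cons {n k m : ℕ} (A : Matrix (Fin k) (Fin n) ℝ) (b : Fin k → ℝ) (ϱ : Fin k → Activation)
      (H : HiddenLayers k m) : HiddenLayers n m

/-- The number of nonzero entries of a matrix. -/
def matNnz {α β : Type} [Fintype α] [Fintype β] (A : Matrix α β ℝ) : ℕ :=
  (Finset.univ.filter fun p : α × β => A p.1 p.2 ≠ 0).card

/-- The number of nonzero entries of a vector. -/
def vecNnz {α : Type} [Fintype α] (b : α → ℝ) : ℕ :=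
  (Finset.univ.filter fun i : α => b i ≠ 0).card

namespace HiddenLayers

/-- `x ↦ x_ℓ`, with `x_ℓ = ϱ_ℓ (A_ℓ x_{ℓ-1} + b_ℓ)`, up to the last hidden layer. -/
def eval : {n m : ℕ} → HiddenLayers n m → (Fin n → ℝ) → (Fin m → ℝ)
  | _, _, nil _, x => x
  | _, _, cons A b ϱ H, x => H.eval fun i => (ϱ i).toFun ((A *ᵥ x + b) i)

/-- The number of hidden layers. -/
def length : {n m : ℕ} → HiddenLayers n m → ℕ
  | _, _, nil _ => 0
  | _, _, cons _ _ _ H => H.length + 1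

/-- The number of nonzero weights and biases. -/
def size : {n m : ℕ} → HiddenLayers n m → ℕ
  | _, _, nil _ => 0
  | _, _, cons A b _ H => matNnz A + vecNnz b + H.size

/-- For each hidden layer the list of its activation functions; the length of that list is the
dimension of the layer. -/
def architecture : {n m : ℕ} → HiddenLayers n m → List (List Activation)
  | _, _, nil _ => []
  | _, _, cons _ _ ϱ H => List.ofFn ϱ :: H.architecture

end HiddenLayers

/-- A neural network with input dimension `d` whose output nodes are indexed by `ι`: hidden layers,
followed by an affine output layer without activation. -/
structure NeuralNet (d : ℕ) (ι : Type) where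
  /-- dimension of the last hidden layer -/
  width : ℕ
  /-- the hidden layers -/
  hidden : HiddenLayers d width
  /-- weights of the output layer -/
  A : Matrix ι (Fin width) ℝ
  /-- biases of the output layer -/
  b : ι → ℝ

namespace NeuralNet

variable {d : ℕ} {ι : Type}

/-- The realization of a network. -/
def realize (Φ : NeuralNet d ι) (x : Fin d → ℝ) : ι → ℝ := Φ.A *ᵥ Φ.hidden.eval x + Φ.b

/-- The number `L(Φ)` of layers. -/
def depth (Φ : NeuralNet d ι) : ℕ := Φ.hidden.length + 1

/-- The number `M(Φ)` of nonzero weights and biases. -/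
def size [Fintype ι] (Φ : NeuralNet d ι) : ℕ := Φ.hidden.size + matNnz Φ.A + vecNnz Φ.b

/-- All hidden layers, with weights, biases and activations. -/
def hiddenPart (Φ : NeuralNet d ι) : Σ w : ℕ, HiddenLayers d w := ⟨Φ.width, Φ.hidden⟩

end NeuralNet

/-! ### Polytopal domains and regular simplicial triangulations -/

/-- Bounded polytopal domains: bounded, open and connected, with a closure that is a finite union of
convex polytopes. A domain does not lie on both sides of its boundary (no slits, no removed
points). -/
structure IsPolytopalDomain {d : ℕ} (D : Set (Fin d → ℝ)) : Prop where
  isOpen : IsOpen D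
  isConnected : IsConnected D
  isBounded : Bornology.IsBounded D
  interior_closure : interior (closure D) = D
  polytopal : ∃ P : Finset (Finset (Fin d → ℝ)),
    closure D = ⋃ Q ∈ P, convexHull ℝ (Q : Set (Fin d → ℝ))

/-- Regular simplicial triangulations of `D`. A simplex is represented by the set of its vertices;
distinct simplices meet in the simplex spanned by their common vertices (or not at all). -/
structure IsRegularTriangulation {d : ℕ} (D : Set (Fin d → ℝ))
    (T : Finset (Finset (Fin d → ℝ))) : Prop where
  card_eq : ∀ K ∈ T, K.card = d + 1
  affineIndependent : ∀ K ∈ T, AffineIndependent ℝ (fun a : K => (a : Fin d → ℝ))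
  closure_eq : closure D = ⋃ K ∈ T, convexHull ℝ (K : Set (Fin d → ℝ))
  inter_eq : ∀ K ∈ T, ∀ K' ∈ T, K ≠ K' →
    convexHull ℝ (K : Set (Fin d → ℝ)) ∩ convexHull ℝ (K' : Set (Fin d → ℝ)) =
      convexHull ℝ ((K : Set (Fin d → ℝ)) ∩ (K' : Set (Fin d → ℝ)))

open Classical in
/-- The subsimplices with `n` vertices of the simplices of `T`: the vertices of `T` for `n = 1`, the
edges for `n = 2`, the faces for `n = d`. -/
def subsimplices {d : ℕ} (T : Finset (Finset (Fin d → ℝ))) (n : ℕ) :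
    Finset (Finset (Fin d → ℝ)) :=
  T.biUnion fun K => K.powersetCard n

/-- `s(σ)`, the number of simplices of `T` that share the subsimplex `σ`. -/
def starCard {d : ℕ} (T : Finset (Finset (Fin d → ℝ))) (σ : Finset (Fin d → ℝ)) : ℕ :=
  letI := Classical.decPred fun K : Finset (Fin d → ℝ) => σ ⊆ K
  (T.filter fun K => σ ⊆ K).card

/-! ### Lowest order finite element spaces -/

/-- Continuous piecewise linear, Nédélec and Raviart-Thomas elements of lowest order. -/
inductive FEKind : Type
  | S1 : FEKind
  | N0 : FEKind
  | RT0 : FEKind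

/-- The number of components of the functions. -/
def FEKind.valDim : FEKind → ℕ → ℕ
  | .S1, _ => 1
  | .N0, d => d
  | .RT0, d => d

/-- The number of vertices of the subsimplices that carry the degrees of freedom. -/
def FEKind.numVertices : FEKind → ℕ → ℕ
  | .S1, _ => 1
  | .N0, _ => 2
  | .RT0, d => d

/-- Vector fields (or scalar functions, for `S1`) on `ℝ^d`. -/
abbrev Field (d : ℕ) (κ : FEKind) : Type := (Fin d → ℝ) → Fin (κ.valDim d) → ℝ

/-- The polynomial space on one simplex: affine functions for `S1`, fields `x ↦ a + B x` with `B`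
skew-symmetric for `N0`, fields `x ↦ a + b x` with a scalar `b` for `RT0`. -/
def IsLocal {d : ℕ} : (κ : FEKind) → Field d κ → Prop
  | .S1, p => ∃ (g : Fin d → ℝ) (c : ℝ), ∀ x, p x = fun _ => g ⬝ᵥ x + c
  | .N0, p => ∃ (a : Fin d → ℝ) (B : Matrix (Fin d) (Fin d) ℝ), Bᵀ = -B ∧ ∀ x, p x = a + B *ᵥ x
  | .RT0, p => ∃ (a : Fin d → ℝ) (b : ℝ), ∀ x, p x = a + b • x

/-- `ν` is orthogonal to the simplex with vertex set `f`. -/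
def IsNormal {d : ℕ} (f : Finset (Fin d → ℝ)) (ν : Fin d → ℝ) : Prop :=
  ∀ a ∈ f, ∀ b ∈ f, ν ⬝ᵥ (a - b) = 0

/-- The traces of `p` (from `K`) and of `q` (from `K'`) coincide on the intersection of the two
simplices: the values for `S1`, the tangential components for `N0`, the normal components on common
faces for `RT0`. -/
def TraceEq {d : ℕ} : (κ : FEKind) → (K K' : Finset (Fin d → ℝ)) → (p q : Field d κ) → Prop
  | .S1, K, K', p, q =>
      ∀ x ∈ convexHull ℝ (K : Set (Fin d → ℝ)) ∩ convexHull ℝ (K' : Set (Fin d → ℝ)), p x = q x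
  | .N0, K, K', p, q =>
      ∀ x ∈ convexHull ℝ (K : Set (Fin d → ℝ)) ∩ convexHull ℝ (K' : Set (Fin d → ℝ)),
      ∀ y ∈ convexHull ℝ (K : Set (Fin d → ℝ)) ∩ convexHull ℝ (K' : Set (Fin d → ℝ)),
        (p x : Fin d → ℝ) ⬝ᵥ (y - x) = (q x : Fin d → ℝ) ⬝ᵥ (y - x)
  | .RT0, K, K', p, q =>
      ∀ f ⊆ K, f ⊆ K' → f.card = d → ∀ ν, IsNormal f ν →
      ∀ x ∈ convexHull ℝ (f : Set (Fin d → ℝ)),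
        (p x : Fin d → ℝ) ⬝ᵥ ν = (q x : Fin d → ℝ) ⬝ᵥ ν

/-- The trace of `p` (from `K`) vanishes on the part `Γ` of the boundary: the value for `S1`, the
tangential component for `N0`, the normal component for `RT0`. -/
def ZeroTrace {d : ℕ} (Γ : Set (Fin d → ℝ)) :
    (κ : FEKind) → (K : Finset (Fin d → ℝ)) → (p : Field d κ) → Prop
  | .S1, K, p => ∀ x ∈ convexHull ℝ (K : Set (Fin d → ℝ)) ∩ Γ, p x = 0
  | .N0, K, p =>
      ∀ σ ⊆ K, convexHull ℝ (σ : Set (Fin d → ℝ)) ⊆ Γ →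
      ∀ x ∈ convexHull ℝ (σ : Set (Fin d → ℝ)), ∀ y ∈ convexHull ℝ (σ : Set (Fin d → ℝ)),
        (p x : Fin d → ℝ) ⬝ᵥ (y - x) = 0
  | .RT0, K, p =>
      ∀ f ⊆ K, f.card = d → convexHull ℝ (f : Set (Fin d → ℝ)) ⊆ Γ → ∀ ν, IsNormal f ν →
      ∀ x ∈ convexHull ℝ (f : Set (Fin d → ℝ)), (p x : Fin d → ℝ) ⬝ᵥ ν = 0

/-- A finite element of lowest order, with a part `bdry` of the boundary on which a homogeneous
essential boundary condition is imposed (none if `bdry = ∅`). -/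
structure Factor (d : ℕ) where
  /-- the type of the element -/
  kind : FEKind
  /-- where the homogeneous essential boundary condition is imposed -/
  bdry : Set (Fin d → ℝ)

/-- The number of components of the functions. -/
abbrev Factor.valDim {d : ℕ} (F : Factor d) : ℕ := F.kind.valDim d

/-- A family of local polynomials, one for each simplex, with single-valued traces and with the
essential boundary condition. -/
structure IsPiecewise {d : ℕ} (T : Finset (Finset (Fin d → ℝ))) (F : Factor d)
    (p : Finset (Fin d → ℝ) → Field d F.kind) : Prop where
  isLocal : ∀ K ∈ T, IsLocal F.kind (p K)
  traceEq : ∀ K ∈ T, ∀ K' ∈ T, TraceEq F.kind K K' (p K) (p K')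
  zeroTrace : ∀ K ∈ T, ZeroTrace F.bdry F.kind K (p K)

theorem IsPiecewise.zero {d : ℕ} {T : Finset (Finset (Fin d → ℝ))} {F : Factor d} :
    IsPiecewise T F (fun _ _ => 0) := by
  obtain ⟨κ, Γ⟩ := F
  constructor
  · intro K _
    cases κ
    · exact ⟨0, 0, fun x => by funext i; simp⟩
    · exact ⟨0, 0, by simp, fun x => by simp; rfl⟩
    · exact ⟨0, 0, fun x => by simp; rfl⟩
  · intro K _ K' _
    cases κ <;> simp [TraceEq]
  · intro K _
    cases κ
    · intro x _; rfl
    · intro σ _ _ x _ y _; exact zero_dotProduct _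
    · intro f _ _ _ ν _ x _; exact zero_dotProduct _

theorem IsPiecewise.add {d : ℕ} {T : Finset (Finset (Fin d → ℝ))} {F : Factor d}
    {p q : Finset (Fin d → ℝ) → Field d F.kind} (hp : IsPiecewise T F p)
    (hq : IsPiecewise T F q) : IsPiecewise T F (fun K x => p K x + q K x) := by
  obtain ⟨κ, Γ⟩ := F
  constructor
  · intro K hK
    have h1 := hp.isLocal K hK
    have h2 := hq.isLocal K hK
    cases κ
    · obtain ⟨g, c, h1⟩ := h1
      obtain ⟨g', c', h2⟩ := h2
      refine ⟨g + g', c + c', fun x => ?_⟩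
      simp only [h1, h2]
      funext i
      simp only [Pi.add_apply, add_dotProduct]
      ring
    · obtain ⟨a, B, hB, h1⟩ := h1
      obtain ⟨a', B', hB', h2⟩ := h2
      refine ⟨a + a', B + B', by rw [Matrix.transpose_add, hB, hB', neg_add], fun x => ?_⟩
      simp only [h1, h2, Matrix.add_mulVec]
      exact add_add_add_comm _ _ _ _
    · obtain ⟨a, b, h1⟩ := h1
      obtain ⟨a', b', h2⟩ := h2
      refine ⟨a + a', b + b', fun x => ?_⟩
      simp only [h1, h2, add_smul]
      exact add_add_add_comm _ _ _ _
  · intro K hK K' hK'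
    have h1 := hp.traceEq K hK K' hK'
    have h2 := hq.traceEq K hK K' hK'
    cases κ
    · intro x hx
      exact congrArg₂ (· + ·) (h1 x hx) (h2 x hx)
    · intro x hx y hy
      exact (add_dotProduct _ _ _).trans ((congrArg₂ (· + ·) (h1 x hx y hy) (h2 x hx y hy)).trans
        (add_dotProduct _ _ _).symm)
    · intro f hf hf' hd ν hν x hx
      exact (add_dotProduct _ _ _).trans ((congrArg₂ (· + ·) (h1 f hf hf' hd ν hν x hx)
        (h2 f hf hf' hd ν hν x hx)).trans (add_dotProduct _ _ _).symm)
  · intro K hK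
    have h1 := hp.zeroTrace K hK
    have h2 := hq.zeroTrace K hK
    cases κ
    · intro x hx
      simp only [h1 x hx, h2 x hx, add_zero]
    · intro σ hσ hΓ x hx y hy
      exact (add_dotProduct _ _ _).trans ((congrArg₂ (· + ·) (h1 σ hσ hΓ x hx y hy)
        (h2 σ hσ hΓ x hx y hy)).trans (add_zero 0))
    · intro f hf hd hΓ ν hν x hx
      exact (add_dotProduct _ _ _).trans ((congrArg₂ (· + ·) (h1 f hf hd hΓ ν hν x hx)
        (h2 f hf hd hΓ ν hν x hx)).trans (add_zero 0))

theorem IsPiecewise.smul {d : ℕ} {T : Finset (Finset (Fin d → ℝ))} {F : Factor d} (c : ℝ)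
    {p : Finset (Fin d → ℝ) → Field d F.kind} (hp : IsPiecewise T F p) :
    IsPiecewise T F (fun K x => c • p K x) := by
  obtain ⟨κ, Γ⟩ := F
  constructor
  · intro K hK
    have h1 := hp.isLocal K hK
    cases κ
    · obtain ⟨g, e, h1⟩ := h1
      refine ⟨c • g, c * e, fun x => ?_⟩
      simp only [h1]
      funext i
      simp only [Pi.smul_apply, smul_dotProduct, smul_eq_mul]
      ring
    · obtain ⟨a, B, hB, h1⟩ := h1
      refine ⟨c • a, c • B, by rw [Matrix.transpose_smul, hB, smul_neg], fun x => ?_⟩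
      simp only [h1, Matrix.smul_mulVec]
      exact smul_add _ _ _
    · obtain ⟨a, b, h1⟩ := h1
      refine ⟨c • a, c * b, fun x => ?_⟩
      simp only [h1, mul_smul]
      exact smul_add _ _ _
  · intro K hK K' hK'
    have h1 := hp.traceEq K hK K' hK'
    cases κ
    · intro x hx
      exact congrArg (c • ·) (h1 x hx)
    · intro x hx y hy
      exact (smul_dotProduct _ _ _).trans ((congrArg (c • ·) (h1 x hx y hy)).trans
        (smul_dotProduct _ _ _).symm)
    · intro f hf hf' hd ν hν x hx
      exact (smul_dotProduct _ _ _).trans ((congrArg (c • ·) (h1 f hf hf' hd ν hν x hx)).trans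
        (smul_dotProduct _ _ _).symm)
  · intro K hK
    have h1 := hp.zeroTrace K hK
    cases κ
    · intro x hx
      simp only [h1 x hx, smul_zero]
    · intro σ hσ hΓ x hx y hy
      exact (smul_dotProduct _ _ _).trans ((congrArg (c • ·) (h1 σ hσ hΓ x hx y hy)).trans
        (smul_zero c))
    · intro f hf hd hΓ ν hν x hx
      exact (smul_dotProduct _ _ _).trans ((congrArg (c • ·) (h1 f hf hd hΓ ν hν x hx)).trans
        (smul_zero c))

/-- The finite element space on `D`, a space of classes of functions modulo equality almost
everywhere in `D`. -/
def feSpace {d : ℕ} (D : Set (Fin d → ℝ)) (T : Finset (Finset (Fin d → ℝ))) (F : Factor d) :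
    Submodule ℝ ((Fin d → ℝ) →ₘ[volume.restrict D] (Fin F.valDim → ℝ)) where
  carrier := {v | ∃ p : Finset (Fin d → ℝ) → Field d F.kind, IsPiecewise T F p ∧
    ∀ K ∈ T, ∀ᵐ x ∂(volume.restrict D), x ∈ convexHull ℝ (K : Set (Fin d → ℝ)) → v x = p K x}
  zero_mem' := by
    refine ⟨fun _ _ => 0, IsPiecewise.zero, fun K _ => ?_⟩
    filter_upwards [AEEqFun.coeFn_zero (α := Fin d → ℝ) (μ := volume.restrict D)
      (β := Fin F.valDim → ℝ)] with x hx _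
    rw [hx]; rfl
  add_mem' := by
    rintro v w ⟨p, hp, hv⟩ ⟨q, hq, hw⟩
    refine ⟨_, hp.add hq, fun K hK => ?_⟩
    filter_upwards [AEEqFun.coeFn_add v w, hv K hK, hw K hK] with x hx h1 h2 hxK
    rw [hx, Pi.add_apply, h1 hxK, h2 hxK]
  smul_mem' := by
    rintro c v ⟨p, hp, hv⟩
    refine ⟨_, hp.smul c, fun K hK => ?_⟩
    filter_upwards [AEEqFun.coeFn_smul c v, hv K hK] with x hx h1 hxK
    rw [hx, Pi.smul_apply, h1 hxK]

/-! ### Shape functions -/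

open Classical in
/-- The index set of the shape functions: the vertices, edges or faces of `T` that are not contained
in the part of the boundary with an essential boundary condition. -/
def indexSet {d : ℕ} (T : Finset (Finset (Fin d → ℝ))) (F : Factor d) :
    Finset (Finset (Fin d → ℝ)) :=
  (subsimplices T (F.kind.numVertices d)).filter fun σ =>
    ¬ convexHull ℝ (σ : Set (Fin d → ℝ)) ⊆ F.bdry

open Classical in
/-- The barycentric coordinate of the `d`-simplex `K` that belongs to the vertex `a`. -/
def bary {d : ℕ} (K : Finset (Fin d → ℝ)) (a : Fin d → ℝ) : (Fin d → ℝ) →ᵃ[ℝ] ℝ :=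
  Classical.epsilon fun l : (Fin d → ℝ) →ᵃ[ℝ] ℝ => ∀ b ∈ K, l b = if b = a then 1 else 0

/-- The gradient of an affine function. -/
def grad {d : ℕ} (l : (Fin d → ℝ) →ᵃ[ℝ] ℝ) : Fin d → ℝ := fun i => l.linear (Pi.single i 1)

/-- Orientations and normalizations of the edges and faces. -/
structure Orientation (d : ℕ) where
  /-- start of an edge -/
  tail : Finset (Fin d → ℝ) → (Fin d → ℝ)
  /-- end of an edge -/
  head : Finset (Fin d → ℝ) → (Fin d → ℝ)
  /-- normalization of the shape function of an edge -/
  scale : Finset (Fin d → ℝ) → ℝ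
  /-- a normal vector of a face, not necessarily of length one -/
  normal : Finset (Fin d → ℝ) → (Fin d → ℝ)

open Classical in
/-- `o` orients all edges and faces of `T`. -/
structure Orientation.IsFor {d : ℕ} (o : Orientation d) (T : Finset (Finset (Fin d → ℝ))) :
    Prop where
  edge : ∀ e ∈ subsimplices T 2, e = {o.tail e, o.head e}
  scale_ne_zero : ∀ e ∈ subsimplices T 2, o.scale e ≠ 0
  isNormal : ∀ f ∈ subsimplices T d, IsNormal f (o.normal f)
  normal_ne_zero : ∀ f ∈ subsimplices T d, o.normal f ≠ 0

open Classical in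
/-- The restriction to the simplex `K` of the shape function of a subsimplex `σ` of `K`.
* `S1`: the barycentric coordinate `λ_a` for `σ = {a}`.
* `N0`: a multiple of the Whitney function `λ_a ∇λ_b - λ_b ∇λ_a` for `σ = {a, b}`.
* `RT0`: for `σ = K \ {a}`, the multiple of `x ↦ x - a` whose component in the direction of the
  chosen normal vector `ν` of `σ` is `1` on `σ`, that is the field
  `± |σ| / (d |K|) (x - a)` if `ν` has length one. -/
def localShape {d : ℕ} (o : Orientation d) :
    (κ : FEKind) → (K σ : Finset (Fin d → ℝ)) → Field d κ
  | .S1, K, σ, x => fun _ => ∑ a ∈ σ, bary K a x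
  | .N0, K, σ, x => (o.scale σ • (bary K (o.tail σ) x • grad (bary K (o.head σ)) -
      bary K (o.head σ) x • grad (bary K (o.tail σ))) : Fin d → ℝ)
  | .RT0, K, σ, x => (∑ a ∈ K \ σ, ((d : ℝ) / ∑ q ∈ σ, o.normal σ ⬝ᵥ (q - a)) • (x - a) :
      Fin d → ℝ)

open Classical in
/-- The shape function of the subsimplex `σ`, supported in the simplices of `T` that share `σ`. -/
def shapeFun {d : ℕ} (T : Finset (Finset (Fin d → ℝ))) (o : Orientation d) (κ : FEKind)
    (σ : Finset (Fin d → ℝ)) : Field d κ := fun x =>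
  ∑ K ∈ T.filter fun K => σ ⊆ K,
    (interior (convexHull ℝ (K : Set (Fin d → ℝ)))).indicator (localShape o κ K σ) x

/-! ### The product spaces -/

/-- The space-time cylinder `(0, τ) × G`; the time is the coordinate with index `0`. -/
def cylinder {n : ℕ} (τ : ℝ) (G : Set (Fin n → ℝ)) : Set (Fin (n + 1) → ℝ) :=
  {x | x 0 ∈ Set.Ioo 0 τ ∧ Fin.tail x ∈ G}

/-- The lateral boundary `[0, τ] × ∂G` of the space-time cylinder. -/
def lateralBoundary {n : ℕ} (τ : ℝ) (G : Set (Fin n → ℝ)) : Set (Fin (n + 1) → ℝ) :=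
  {x | x 0 ∈ Set.Icc 0 τ ∧ Fin.tail x ∈ frontier G}

/-- The four families of product spaces. -/
inductive Problem : Type
  | poisson : Problem
  | elasticity : Problem
  | maxwell : Problem
  | spaceTime : Problem

/-- `IsProductSpace P δ D F`: the factors `F` are those of the product space of the problem `P` on
the domain `D`, where `δ` is the dimension of the (spatial) domain. -/
inductive IsProductSpace : Problem → ℕ → {d m : ℕ} → Set (Fin d → ℝ) → (Fin m → Factor d) → Prop
  /-- `(S1 ∩ H¹₀) × RT0` -/
  | poisson {d : ℕ} (hd : 2 ≤ d) {D : Set (Fin d → ℝ)} (hD : IsPolytopalDomain D) :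
      IsProductSpace .poisson d D ![⟨.S1, frontier D⟩, ⟨.RT0, ∅⟩]
  /-- `(S1 ∩ H¹₀)^d × RT0^d` -/
  | elasticity {d : ℕ} (hd : 2 ≤ d) {D : Set (Fin d → ℝ)} (hD : IsPolytopalDomain D) :
      IsProductSpace .elasticity d D
        (Fin.append (fun _ : Fin d => (⟨.S1, frontier D⟩ : Factor d))
          (fun _ : Fin d => (⟨.RT0, ∅⟩ : Factor d)))
  /-- `(N0 ∩ H₀(curl)) × N0` -/
  | maxwell {d : ℕ} (hd : 2 ≤ d) (hd3 : d ≤ 3) {D : Set (Fin d → ℝ)} (hD : IsPolytopalDomain D) :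
      IsProductSpace .maxwell d D ![⟨.N0, frontier D⟩, ⟨.N0, ∅⟩]
  /-- `(S1 ∩ L²(I; H¹₀(G))) × S1^n` on `I × G`, with `I = (0, τ)` and `G ⊆ ℝ^n` -/
  | spaceTime {n : ℕ} (hn : 1 ≤ n) {τ : ℝ} (hτ : 0 < τ) {G : Set (Fin n → ℝ)}
      (hG : IsPolytopalDomain G) :
      IsProductSpace .spaceTime n (cylinder τ G)
        (Fin.cons (⟨.S1, lateralBoundary τ G⟩ : Factor (n + 1))
          (fun _ : Fin n => (⟨.S1, ∅⟩ : Factor (n + 1))))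

section Product

variable {d m : ℕ}

/-- The product space of the finite element spaces of all factors. -/
abbrev ProductSpace (D : Set (Fin d → ℝ)) (T : Finset (Finset (Fin d → ℝ)))
    (F : Fin m → Factor d) : Type := ∀ k, feSpace D T (F k)

/-- The index set `ℐ` of all shape functions, whose elements are pairs of a factor `k` and a
subsimplex of `T`. -/
abbrev Index (T : Finset (Finset (Fin d → ℝ))) (F : Fin m → Factor d) : Type :=
  Σ k : Fin m, {σ : Finset (Fin d → ℝ) // σ ∈ indexSet T (F k)}

/-- `∑_{i ∈ ℐ} s(i)`. -/
def starSum (T : Finset (Finset (Fin d → ℝ))) (F : Fin m → Factor d) : ℕ :=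
  ∑ i : Index T F, starCard T i.2

/-- `max_{i ∈ ℐ} s(i)`. -/
def starMax (T : Finset (Finset (Fin d → ℝ))) (F : Fin m → Factor d) : ℕ :=
  Finset.univ.sup fun i : Index T F => starCard T i.2

/-- The family `(s(i))_{i ∈ ℐ}` up to the order in each factor; in particular this list determines
the number of shape functions of each factor. -/
def starData (T : Finset (Finset (Fin d → ℝ))) (F : Fin m → Factor d) : List (Multiset ℕ) :=
  List.ofFn fun k => (indexSet T (F k)).val.map (starCard T)

end Product

end Fosls

end

noncomputable section

namespace Fosls

/-! ### Simplices and barycentric coordinates -/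

/-! The statement splits into a finite element part and a network part.

Finite elements. On one simplex the shape functions are dual to the functionals `dof`
(`dof_localShape`), and a local polynomial on which all these functionals vanish is zero
(`IsLocal.eq_zero_of_dof`). The functionals see only traces, so for a conforming field they are
single-valued, and they vanish on subsimplices where the boundary condition is imposed. Conversely,
shape functions of the remaining subsimplices are conforming (`isPiecewise_shapePiece`). Hence
`combination` is bijective, which gives the dimension and the unique coefficients. The delicate
point is the boundary condition for `S1`: a simplex may touch the boundary in a subsimplex all of
whose vertices one would have to know to be boundary vertices. A homothety centred at a vertex off
the boundary part, together with `interior (closure D) = D` (or the same for `G`), shows that its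
hat function vanishes there.

Networks. A shape function is a sum, over the simplices that share its subsimplex, of an affine
field times the indicator of the open simplex. An open simplex is where `d + 1` affine functions are
positive, so two BiSU layers compute its indicator `χ`. If `|y| ≤ M`, then `χ y = ρ(y + Mχ - M) -
ρ(-y + Mχ - M)`. Each pair of a shape function and a simplex thus costs one block with `O(d ^ 2)`
weights (`eval_blockLayers`, `size_blockLayers_le`), and there are `starSum T F` such pairs.
Coefficients enter only in the output layer, so the hidden layers are the same for all `v`. The
realization recovers `v`, so `v ↦ Ψ v` is injective and carries the vector space structure to the
set of networks. -/

/-- The vertex sets of nondegenerate `d`-simplices in `ℝ^d`. -/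
structure IsSimplex {d : ℕ} (K : Finset (Fin d → ℝ)) : Prop where
  card_eq : K.card = d + 1
  affineIndependent : AffineIndependent ℝ (fun a : K => (a : Fin d → ℝ))

theorem IsRegularTriangulation.isSimplex {d : ℕ} {D : Set (Fin d → ℝ)}
    {T : Finset (Finset (Fin d → ℝ))} (hT : IsRegularTriangulation D T)
    {K : Finset (Fin d → ℝ)} (hK : K ∈ T) : IsSimplex K :=
  ⟨hT.card_eq K hK, hT.affineIndependent K hK⟩

theorem affineMap_eqOn_convexHull {d : ℕ} {V : Type*} [AddCommGroup V] [Module ℝ V]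
    {f g : (Fin d → ℝ) →ᵃ[ℝ] V} {s : Set (Fin d → ℝ)} (h : Set.EqOn f g s) :
    Set.EqOn f g (convexHull ℝ s) :=
  (AffineMap.eqOn_affineSpan h).mono (convexHull_subset_affineSpan s)

theorem linear_apply_eq_grad_dotProduct {d : ℕ} (l : (Fin d → ℝ) →ᵃ[ℝ] ℝ) (x : Fin d → ℝ) :
    l.linear x = grad l ⬝ᵥ x := by
  conv_lhs => rw [pi_eq_sum_univ' x]
  simp [grad, dotProduct, mul_comm]

theorem grad_dotProduct_sub {d : ℕ} (l : (Fin d → ℝ) →ᵃ[ℝ] ℝ) (x y : Fin d → ℝ) :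
    grad l ⬝ᵥ (y - x) = l y - l x := by
  rw [← linear_apply_eq_grad_dotProduct]
  exact l.linearMap_vsub y x

theorem apply_eq_grad_dotProduct_add {d : ℕ} (l : (Fin d → ℝ) →ᵃ[ℝ] ℝ) (x : Fin d → ℝ) :
    l x = grad l ⬝ᵥ x + l 0 := by
  have := grad_dotProduct_sub l 0 x
  rw [sub_zero] at this
  linarith

namespace IsSimplex

variable {d : ℕ} {K : Finset (Fin d → ℝ)}

theorem affineSpan_eq_top (hK : IsSimplex K) :
    affineSpan ℝ (K : Set (Fin d → ℝ)) = ⊤ := by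
  have h := hK.affineIndependent.affineSpan_eq_top_iff_card_eq_finrank_add_one.2
    (by simp [hK.card_eq])
  simpa using h

/-- The vertices of a simplex as an affine basis. -/
def affineBasis (hK : IsSimplex K) : AffineBasis K ℝ (Fin d → ℝ) :=
  ⟨fun a => a, hK.affineIndependent, by simpa using hK.affineSpan_eq_top⟩

theorem affineBasis_apply (hK : IsSimplex K) (a : K) : hK.affineBasis a = a := rfl

theorem range_affineBasis (hK : IsSimplex K) :
    Set.range hK.affineBasis = (K : Set (Fin d → ℝ)) := by
  ext x; simp [affineBasis_apply]

theorem affineMap_ext (hK : IsSimplex K) {V : Type*} [AddCommGroup V] [Module ℝ V]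
    {f g : (Fin d → ℝ) →ᵃ[ℝ] V} (h : ∀ a ∈ K, f a = g a) : f = g :=
  AffineMap.ext_on hK.affineSpan_eq_top h

-- `bary` is an epsilon choice and needs a witness: a coordinate of the affine basis if `a` is a
-- vertex, the zero map otherwise. The second case is used as well, since it lets the `S1` and `N0`
-- formulas vanish by themselves on simplices that do not contain the subsimplex.
open Classical in
theorem bary_apply (hK : IsSimplex K) (a : Fin d → ℝ) {b : Fin d → ℝ} (hb : b ∈ K) :
    bary K a b = if b = a then 1 else 0 := by
  refine Classical.epsilon_spec
    (p := fun l : (Fin d → ℝ) →ᵃ[ℝ] ℝ => ∀ b ∈ K, l b = if b = a then 1 else 0) ?_ b hb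
  by_cases ha : a ∈ K
  · refine ⟨hK.affineBasis.coord ⟨a, ha⟩, fun b hb => ?_⟩
    have := hK.affineBasis.coord_apply ⟨a, ha⟩ ⟨b, hb⟩
    rw [affineBasis_apply] at this
    simp only [this, Subtype.mk.injEq, eq_comm]
  · refine ⟨0, fun b hb => ?_⟩
    rw [if_neg (fun h : b = a => ha (h ▸ hb))]
    rfl

theorem bary_self (hK : IsSimplex K) {a : Fin d → ℝ} (ha : a ∈ K) : bary K a a = 1 := by
  rw [hK.bary_apply a ha, if_pos rfl]

theorem bary_of_ne (hK : IsSimplex K) {a b : Fin d → ℝ} (hb : b ∈ K) (h : b ≠ a) :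
    bary K a b = 0 := by
  rw [hK.bary_apply a hb, if_neg h]

theorem bary_eq_coord (hK : IsSimplex K) {a : Fin d → ℝ} (ha : a ∈ K) :
    bary K a = hK.affineBasis.coord ⟨a, ha⟩ := by
  classical
  refine hK.affineMap_ext fun b hb => ?_
  have := hK.affineBasis.coord_apply ⟨a, ha⟩ ⟨b, hb⟩
  rw [affineBasis_apply] at this
  simp only [this, hK.bary_apply a hb, Subtype.mk.injEq, eq_comm]

theorem mem_convexHull_iff (hK : IsSimplex K) {x : Fin d → ℝ} :
    x ∈ convexHull ℝ (K : Set (Fin d → ℝ)) ↔ ∀ a ∈ K, 0 ≤ bary K a x := by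
  rw [← hK.range_affineBasis, hK.affineBasis.convexHull_eq_nonneg_coord]
  constructor
  · intro h a ha
    rw [hK.bary_eq_coord ha]
    exact h _
  · rintro h ⟨a, ha⟩
    rw [← hK.bary_eq_coord ha]
    exact h a ha

theorem mem_interior_convexHull_iff (hK : IsSimplex K) {x : Fin d → ℝ} :
    x ∈ interior (convexHull ℝ (K : Set (Fin d → ℝ))) ↔ ∀ a ∈ K, 0 < bary K a x := by
  rw [← hK.range_affineBasis, hK.affineBasis.interior_convexHull]
  constructor
  · intro h a ha
    rw [hK.bary_eq_coord ha]
    exact h _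
  · rintro h ⟨a, ha⟩
    rw [← hK.bary_eq_coord ha]
    exact h a ha

theorem interior_convexHull_nonempty (hK : IsSimplex K) :
    (interior (convexHull ℝ (K : Set (Fin d → ℝ)))).Nonempty :=
  interior_convexHull_nonempty_iff_affineSpan_eq_top.2 hK.affineSpan_eq_top

theorem sum_bary (hK : IsSimplex K) (x : Fin d → ℝ) : ∑ a ∈ K, bary K a x = 1 := by
  rw [← hK.affineBasis.sum_coord_apply_eq_one x, ← Finset.sum_attach, Finset.univ_eq_attach]
  exact Finset.sum_congr rfl fun a _ => by rw [hK.bary_eq_coord a.2]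

theorem sum_bary_smul (hK : IsSimplex K) (x : Fin d → ℝ) : ∑ a ∈ K, bary K a x • a = x := by
  conv_rhs => rw [← hK.affineBasis.linear_combination_coord_eq_self x]
  rw [← Finset.sum_attach, Finset.univ_eq_attach]
  exact Finset.sum_congr rfl fun a _ => by rw [hK.bary_eq_coord a.2]; rfl

/-- Points are determined by their barycentric coordinates. -/
theorem ext_bary (hK : IsSimplex K) {x y : Fin d → ℝ} (h : ∀ a ∈ K, bary K a x = bary K a y) :
    x = y := by
  rw [← hK.sum_bary_smul x, ← hK.sum_bary_smul y]
  exact Finset.sum_congr rfl fun a ha => by rw [h a ha]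

theorem bary_eq_zero_of_notMem (hK : IsSimplex K) {s : Set (Fin d → ℝ)} (hs : s ⊆ K)
    {a : Fin d → ℝ} (ha : a ∉ s) {x : Fin d → ℝ} (hx : x ∈ convexHull ℝ s) :
    bary K a x = 0 :=
  affineMap_eqOn_convexHull (f := bary K a) (g := 0)
    (fun _ hb => hK.bary_of_ne (hs hb) (fun h => ha (h ▸ hb))) hx

/-- Two simplices have the same barycentric coordinates on a common subsimplex. -/
theorem bary_eq_bary (hK : IsSimplex K) {K' : Finset (Fin d → ℝ)} (hK' : IsSimplex K')
    {s : Set (Fin d → ℝ)} (hs : s ⊆ K) (hs' : s ⊆ K') (a : Fin d → ℝ) {x : Fin d → ℝ}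
    (hx : x ∈ convexHull ℝ s) : bary K a x = bary K' a x :=
  affineMap_eqOn_convexHull (f := bary K a) (g := bary K' a)
    (fun _ hb => by rw [hK.bary_apply a (hs hb), hK'.bary_apply a (hs' hb)]) hx

/-- A vector that is orthogonal to all edges vanishes. -/
theorem eq_zero_of_dotProduct (hK : IsSimplex K) {a w : Fin d → ℝ}
    (h : ∀ b ∈ K, w ⬝ᵥ (b - a) = 0) : w = 0 := by
  have key : ∀ x, w ⬝ᵥ (x - a) = 0 := by
    intro x
    have hx : x - a = ∑ b ∈ K, bary K b x • (b - a) := by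
      simp only [smul_sub, Finset.sum_sub_distrib, ← Finset.sum_smul, hK.sum_bary_smul,
        hK.sum_bary, one_smul]
    rw [hx, dotProduct_sum]
    exact Finset.sum_eq_zero fun b hb => by rw [dotProduct_smul, h b hb, smul_zero]
  have := key (w + a)
  rwa [add_sub_cancel_right, dotProduct_self_eq_zero] at this

/-- A vector vanishes if all barycentric coordinates are constant in its direction. -/
theorem eq_zero_of_grad_dotProduct (hK : IsSimplex K) {w : Fin d → ℝ}
    (h : ∀ a ∈ K, grad (bary K a) ⬝ᵥ w = 0) : w = 0 := by
  refine hK.ext_bary fun a ha => ?_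
  have := grad_dotProduct_sub (bary K a) 0 w
  rw [sub_zero, h a ha] at this
  linarith

theorem sum_grad_bary (hK : IsSimplex K) : ∑ a ∈ K, grad (bary K a) = 0 := by
  refine dotProduct_self_eq_zero.1 ?_
  generalize hw : ∑ a ∈ K, grad (bary K a) = w
  rw [← sub_zero w]
  nth_rw 1 [sub_zero, ← hw]
  simp only [sum_dotProduct, grad_dotProduct_sub, Finset.sum_sub_distrib, hK.sum_bary, sub_self]

end IsSimplex

/-! ### Regular triangulations -/

namespace IsRegularTriangulation

variable {d : ℕ} {D : Set (Fin d → ℝ)} {T : Finset (Finset (Fin d → ℝ))}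

theorem inter_subset (hT : IsRegularTriangulation D T) {K K' : Finset (Fin d → ℝ)}
    (hK : K ∈ T) (hK' : K' ∈ T) {x : Fin d → ℝ}
    (hx : x ∈ convexHull ℝ (K : Set (Fin d → ℝ)) ∩ convexHull ℝ (K' : Set (Fin d → ℝ))) :
    x ∈ convexHull ℝ ((K : Set (Fin d → ℝ)) ∩ (K' : Set (Fin d → ℝ))) := by
  by_cases h : K = K'
  · subst h
    simpa using hx
  · rwa [← hT.inter_eq K hK K' hK' h]

theorem convexHull_subset_closure (hT : IsRegularTriangulation D T) {K : Finset (Fin d → ℝ)}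
    (hK : K ∈ T) : convexHull ℝ (K : Set (Fin d → ℝ)) ⊆ closure D := by
  rw [hT.closure_eq]
  exact Set.subset_biUnion_of_mem (u := fun K : Finset (Fin d → ℝ) => convexHull ℝ
    (K : Set (Fin d → ℝ))) hK

/-- A common point lies in the hull of the common vertices. All its barycentric coordinates in `K`
are positive, so no vertex of `K` can be missing there. -/
theorem eq_of_mem_interior (hT : IsRegularTriangulation D T) {K K' : Finset (Fin d → ℝ)}
    (hK : K ∈ T) (hK' : K' ∈ T) {x : Fin d → ℝ}
    (hx : x ∈ interior (convexHull ℝ (K : Set (Fin d → ℝ))))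
    (hx' : x ∈ convexHull ℝ (K' : Set (Fin d → ℝ))) : K = K' := by
  have hx2 := hT.inter_subset hK hK' ⟨interior_subset hx, hx'⟩
  have hsub : K ⊆ K' := by
    intro a ha
    by_contra ha'
    have h0 := (hT.isSimplex hK).bary_eq_zero_of_notMem Set.inter_subset_left
      (fun h : a ∈ (K : Set (Fin d → ℝ)) ∩ K' => ha' h.2) hx2
    exact ((hT.isSimplex hK).mem_interior_convexHull_iff.1 hx a ha).ne' h0
  exact Finset.eq_of_subset_of_card_le hsub
    (by rw [hT.card_eq K hK, hT.card_eq K' hK'])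

theorem isBounded (hT : IsRegularTriangulation D T) : Bornology.IsBounded D := by
  refine Bornology.IsBounded.subset ?_ subset_closure
  rw [hT.closure_eq]
  exact (Bornology.isBounded_biUnion_finset T).2 fun K _ =>
    isBounded_convexHull.2 K.finite_toSet.isBounded

/-- Almost every point of `D` is in the interior of a simplex. -/
theorem ae_mem_interior (hD : IsOpen D) (hT : IsRegularTriangulation D T) :
    ∀ᵐ x ∂(volume.restrict D),
      ∃ K ∈ T, x ∈ interior (convexHull ℝ (K : Set (Fin d → ℝ))) := by
  have h0 : ∀ᵐ x ∂(volume.restrict D), ∀ K ∈ T,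
      x ∉ frontier (convexHull ℝ (K : Set (Fin d → ℝ))) := by
    refine (Filter.eventually_all_finset T).2 fun K _ => ae_restrict_of_ae ?_
    exact measure_eq_zero_iff_ae_notMem.1 ((convex_convexHull ℝ _).addHaar_frontier volume)
  filter_upwards [h0, ae_restrict_mem hD.measurableSet] with x hx hxD
  have hxc := subset_closure hxD
  rw [hT.closure_eq, Set.mem_iUnion₂] at hxc
  obtain ⟨K, hK, hxK⟩ := hxc
  refine ⟨K, hK, ?_⟩
  by_contra hi
  exact hx K hK ⟨subset_closure hxK, hi⟩

/-- If `x` has a positive barycentric coordinate for the vertex `a`, then the homothety with center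
`a` that maps `a + s (x - a)` to `x` maps points of the closure of `D` near the former point into
the closure of `D`. -/
theorem eventually_mem_closure (hT : IsRegularTriangulation D T) {K : Finset (Fin d → ℝ)}
    (hK : K ∈ T) {a x : Fin d → ℝ} (ha : a ∈ K)
    (hx : x ∈ convexHull ℝ (K : Set (Fin d → ℝ))) (hax : bary K a x ≠ 0) {s : ℝ} (hs : 0 < s)
    (hs1 : s ≤ 1) :
    ∀ᶠ z in nhds x, a + s • (z - a) ∈ closure D → z ∈ closure D := by
  have hKs := hT.isSimplex hK
  have hax' : 0 < bary K a x := lt_of_le_of_ne (hKs.mem_convexHull_iff.1 hx a ha) hax.symm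
  set h : (Fin d → ℝ) → (Fin d → ℝ) := fun z => a + s • (z - a) with hh
  have hcont : Continuous h := by fun_prop
  have hl : ∀ (l : (Fin d → ℝ) →ᵃ[ℝ] ℝ) z, l (h z) = l a + s * (l z - l a) := by
    intro l z
    rw [← grad_dotProduct_sub l a z, ← smul_eq_mul, ← dotProduct_smul, eq_comm,
      ← eq_sub_iff_add_eq', ← grad_dotProduct_sub, hh]
    simp
  have hconv : h x ∈ convexHull ℝ (K : Set (Fin d → ℝ)) := by
    refine (hKs.mem_convexHull_iff).2 fun b hb => ?_
    have h1 := hKs.mem_convexHull_iff.1 hx b hb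
    have h2 := hKs.mem_convexHull_iff.1 (subset_convexHull ℝ _ ha) b hb
    rw [hl]
    nlinarith
  have hstep : ∀ K' ∈ T, ∀ᶠ z in nhds x, h z ∈ convexHull ℝ (K' : Set (Fin d → ℝ)) →
      z ∈ convexHull ℝ (K' : Set (Fin d → ℝ)) := by
    intro K' hK'
    have hKs' := hT.isSimplex hK'
    by_cases hy : h x ∈ convexHull ℝ (K' : Set (Fin d → ℝ))
    · have hy2 := hT.inter_subset hK hK' ⟨hconv, hy⟩
      have hay : 0 < bary K a (h x) := by
        rw [hl, hKs.bary_self ha]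
        nlinarith
      have ha' : a ∈ K' := by
        by_contra hcon
        exact hay.ne' (hKs.bary_eq_zero_of_notMem Set.inter_subset_left
          (fun hc : a ∈ (K : Set (Fin d → ℝ)) ∩ K' => hcon hc.2) hy2)
      have heq := hKs.bary_eq_bary hKs' Set.inter_subset_left Set.inter_subset_right a hy2
      rw [hl, hl, hKs.bary_self ha, hKs'.bary_self ha'] at heq
      have hpos : 0 < bary K' a x := by nlinarith
      have hev : ∀ᶠ z in nhds x, 0 < bary K' a z :=
        ((bary K' a).continuous_of_finiteDimensional.continuousAt).eventually_const_lt hpos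
      filter_upwards [hev] with z hz hhz
      -- Near `x` only the coordinates at `b ≠ a` are in question; those of `h z` are `s` times
      -- those of `z`, so they have the same sign.
      refine hKs'.mem_convexHull_iff.2 fun b hb => ?_
      by_cases hba : b = a
      · rw [hba]; exact hz.le
      · have := hKs'.mem_convexHull_iff.1 hhz b hb
        rw [hl, hKs'.bary_of_ne ha' (Ne.symm hba)] at this
        nlinarith
    · have hcl : IsClosed (convexHull ℝ (K' : Set (Fin d → ℝ))) :=
        (K'.finite_toSet.isCompact_convexHull ℝ).isClosed
      have := hcont.continuousAt.eventually_mem (hcl.isOpen_compl.mem_nhds hy)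
      filter_upwards [this] with z hz hz'
      exact absurd hz' hz
  filter_upwards [(Filter.eventually_all_finset T).2 hstep] with z hz hzD
  rw [hT.closure_eq, Set.mem_iUnion₂] at hzD ⊢
  obtain ⟨K', hK', hzK'⟩ := hzD
  exact ⟨K', hK', hz K' hK' hzK'⟩

/-- The hat function of an interior vertex vanishes on the boundary. -/
theorem bary_eq_zero_of_mem_frontier (hD : IsOpen D) (hDi : interior (closure D) = D)
    (hT : IsRegularTriangulation D T) {K : Finset (Fin d → ℝ)} (hK : K ∈ T) {a x : Fin d → ℝ}
    (ha : a ∈ K) (haD : a ∉ frontier D)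
    (hx : x ∈ convexHull ℝ (K : Set (Fin d → ℝ)) ∩ frontier D) : bary K a x = 0 := by
  by_contra hax
  have haD' : a ∈ D := by
    by_contra h
    exact haD ⟨hT.convexHull_subset_closure hK (subset_convexHull ℝ _ ha), by rwa [hD.interior_eq]⟩
  have hlim : Filter.Tendsto (fun s : ℝ => a + s • (x - a)) (nhds 0) (nhds a) := by
    have : Continuous fun s : ℝ => a + s • (x - a) := by fun_prop
    simpa using this.tendsto 0
  -- For small `s` the shrunk point is so close to `a` that it lies in the open set `D`. Pulling a
  -- neighbourhood of it back by the homothety fills a neighbourhood of `x` with points of `closure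
  -- D`, so `x` would be an interior point.
  obtain ⟨s, hsD, hs0, hs1⟩ := (((hlim.eventually_mem (hD.mem_nhds haD')).filter_mono
    nhdsWithin_le_nhds).and (Ioc_mem_nhdsGT one_pos)).exists
  have hev := hT.eventually_mem_closure hK ha hx.1 hax hs0 hs1
  have hev2 : ∀ᶠ z in nhds x, a + s • (z - a) ∈ D := by
    have : Continuous fun z : Fin d → ℝ => a + s • (z - a) := by fun_prop
    exact this.continuousAt.eventually_mem (hD.mem_nhds hsD)
  have : x ∈ interior (closure D) := by
    rw [mem_interior_iff_mem_nhds]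
    filter_upwards [hev, hev2] with z hz hz2
    exact hz (subset_closure hz2)
  rw [hDi] at this
  exact hx.2.2 (by rwa [hD.interior_eq])

end IsRegularTriangulation

/-! ### Space-time cylinders -/

section Cylinder

variable {n : ℕ} {τ : ℝ} {G : Set (Fin n → ℝ)}

theorem continuous_fin_tail : Continuous (Fin.tail : (Fin (n + 1) → ℝ) → (Fin n → ℝ)) :=
  continuous_pi fun i => continuous_apply i.succ

theorem isOpen_cylinder (hG : IsOpen G) : IsOpen (cylinder τ G) :=
  (isOpen_Ioo.preimage (continuous_apply 0)).inter (hG.preimage continuous_fin_tail)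

theorem closure_cylinder (hτ : 0 < τ) :
    closure (cylinder τ G) =
      {x : Fin (n + 1) → ℝ | x 0 ∈ Set.Icc 0 τ ∧ Fin.tail x ∈ closure G} := by
  refine subset_antisymm (closure_minimal ?_ ?_) ?_
  · exact fun x hx => ⟨Set.Ioo_subset_Icc_self hx.1, subset_closure hx.2⟩
  · exact (isClosed_Icc.preimage (continuous_apply 0)).inter
      (isClosed_closure.preimage continuous_fin_tail)
  · rintro x ⟨h0, h1⟩
    rw [← closure_Ioo hτ.ne] at h0
    have hc : Continuous fun p : ℝ × (Fin n → ℝ) => (Fin.cons p.1 p.2 : Fin (n + 1) → ℝ) :=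
      continuous_pi fun i => by
        refine Fin.cases ?_ (fun i => ?_) i
        · simpa using continuous_fst
        · simpa using! (continuous_apply i).comp continuous_snd
    have hp : (x 0, Fin.tail x) ∈ closure (Set.Ioo 0 τ ×ˢ G) := by
      rw [closure_prod_eq]; exact ⟨h0, h1⟩
    have := map_mem_closure hc hp (t := cylinder τ G) (fun p hp => by
      simpa [cylinder] using hp)
    simpa using this

/-- The hat function of a vertex that is not on the lateral boundary vanishes on the lateral
boundary. -/
theorem IsRegularTriangulation.bary_eq_zero_of_mem_lateralBoundary (hτ : 0 < τ) (hG : IsOpen G)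
    (hGi : interior (closure G) = G) {T : Finset (Finset (Fin (n + 1) → ℝ))}
    (hT : IsRegularTriangulation (cylinder τ G) T) {K : Finset (Fin (n + 1) → ℝ)} (hK : K ∈ T)
    {a x : Fin (n + 1) → ℝ} (ha : a ∈ K) (haD : a ∉ lateralBoundary τ G)
    (hx : x ∈ convexHull ℝ (K : Set (Fin (n + 1) → ℝ)) ∩ lateralBoundary τ G) :
    bary K a x = 0 := by
  by_contra hax
  have hac := hT.convexHull_subset_closure hK (subset_convexHull ℝ _ ha)
  rw [closure_cylinder hτ] at hac
  obtain ⟨ha0, ha1⟩ := hac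
  have haG : Fin.tail a ∈ G := by
    by_contra h
    exact haD ⟨ha0, ha1, by rwa [hG.interior_eq]⟩
  obtain ⟨hxK, hx0, hx1⟩ := hx
  have hlim : Filter.Tendsto (fun s : ℝ => Fin.tail (a + s • (x - a))) (nhds 0)
      (nhds (Fin.tail a)) := by
    have : Continuous fun s : ℝ => Fin.tail (a + s • (x - a)) :=
      continuous_fin_tail.comp (by fun_prop)
    simpa using this.tendsto 0
  obtain ⟨s, hsD, hs0, hs1⟩ := (((hlim.eventually_mem (hG.mem_nhds haG)).filter_mono
    nhdsWithin_le_nhds).and (Ioc_mem_nhdsGT one_pos)).exists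
  have hev := hT.eventually_mem_closure hK ha hxK hax hs0 hs1
  -- Only the spatial variable moves; the time stays at `x 0`. Both `a` and `x` may lie on the
  -- bottom or the top of the cylinder, where full space-time neighbourhoods leave its closure.
  have hc : Continuous fun w : Fin n → ℝ => (Fin.cons (x 0) w : Fin (n + 1) → ℝ) :=
    continuous_pi fun i => by
      refine Fin.cases ?_ (fun i => ?_) i
      · simpa using continuous_const
      · simpa using continuous_apply i
  have hxc : (Fin.cons (x 0) (Fin.tail x) : Fin (n + 1) → ℝ) = x := Fin.cons_self_tail x
  have hev' : ∀ᶠ w in nhds (Fin.tail x),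
      a + s • ((Fin.cons (x 0) w : Fin (n + 1) → ℝ) - a) ∈ closure (cylinder τ G) →
      (Fin.cons (x 0) w : Fin (n + 1) → ℝ) ∈ closure (cylinder τ G) :=
    (hc.tendsto (Fin.tail x)).eventually (by rwa [hxc])
  have hev2 : ∀ᶠ w in nhds (Fin.tail x),
      Fin.tail (a + s • ((Fin.cons (x 0) w : Fin (n + 1) → ℝ) - a)) ∈ G := by
    have h2 : Continuous fun w : Fin n → ℝ =>
        Fin.tail (a + s • ((Fin.cons (x 0) w : Fin (n + 1) → ℝ) - a)) :=
      continuous_fin_tail.comp (continuous_const.add ((hc.sub continuous_const).const_smul s))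
    exact h2.continuousAt.eventually_mem (hG.mem_nhds (by rwa [hxc]))
  have hmem : Fin.tail x ∈ interior (closure G) := by
    rw [mem_interior_iff_mem_nhds]
    filter_upwards [hev', hev2] with w hw hw2
    rw [closure_cylinder hτ] at hw
    -- The time of the shrunk point is a convex combination of `a 0` and `x 0`.
    have h0 : (a + s • ((Fin.cons (x 0) w : Fin (n + 1) → ℝ) - a)) 0 ∈ Set.Icc 0 τ := by
      have := convex_Icc (0 : ℝ) τ ha0 hx0 (sub_nonneg.2 hs1) hs0.le (by ring)
      simp only [smul_eq_mul] at this
      simp only [Pi.add_apply, Pi.smul_apply, Pi.sub_apply, Fin.cons_zero, smul_eq_mul]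
      convert! this using 1
      ring
    simpa using (hw ⟨h0, subset_closure hw2⟩).2
  rw [hGi] at hmem
  exact hx1.2 (by rwa [hG.interior_eq])

end Cylinder

/-! ### Local polynomial spaces -/

section Local

variable {d : ℕ} {κ : FEKind}

theorem IsLocal.exists_matrix {p : Field d κ} (hp : IsLocal κ p) :
    ∃ (W : Matrix (Fin (κ.valDim d)) (Fin d) ℝ) (w : Fin (κ.valDim d) → ℝ),
      ∀ x, p x = W *ᵥ x + w := by
  cases κ
  · obtain ⟨g, c, hp⟩ := hp
    exact ⟨fun _ => g, fun _ => c, hp⟩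
  · obtain ⟨a, B, -, hp⟩ := hp
    exact ⟨B, a, fun x => (hp x).trans (add_comm _ _)⟩
  · obtain ⟨a, b, hp⟩ := hp
    refine ⟨(b • (1 : Matrix (Fin d) (Fin d) ℝ) : Matrix (Fin d) (Fin d) ℝ), a, fun x => ?_⟩
    rw [hp x, add_comm]
    congr 1
    exact (by simp [Matrix.smul_mulVec] : b • x = (b • (1 : Matrix (Fin d) (Fin d) ℝ)) *ᵥ x)

theorem IsLocal.exists_affineMap {p : Field d κ} (hp : IsLocal κ p) :
    ∃ f : (Fin d → ℝ) →ᵃ[ℝ] (Fin (κ.valDim d) → ℝ), ∀ x, p x = f x := by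
  obtain ⟨W, w, hp⟩ := hp.exists_matrix
  refine ⟨W.mulVecLin.toAffineMap + AffineMap.const ℝ _ w, fun x => ?_⟩
  rw [hp x]
  rfl

theorem IsLocal.continuous {p : Field d κ} (hp : IsLocal κ p) : Continuous p := by
  obtain ⟨f, hf⟩ := hp.exists_affineMap
  rw [funext hf]
  exact f.continuous_of_finiteDimensional

theorem IsLocal.eq_zero_of_vertices {K : Finset (Fin d → ℝ)} (hK : IsSimplex K) {p : Field d κ}
    (hp : IsLocal κ p) (h : ∀ a ∈ K, p a = 0) : p = 0 := by
  obtain ⟨f, hf⟩ := hp.exists_affineMap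
  have : f = 0 := hK.affineMap_ext fun a ha => by rw [← hf, h a ha]; rfl
  funext x
  rw [hf, this]
  rfl

theorem IsLocal.eq_zero_of_isOpen {p : Field d κ} (hp : IsLocal κ p) {U : Set (Fin d → ℝ)}
    (hU : IsOpen U) (hne : U.Nonempty) (h : ∀ x ∈ U, p x = 0) : p = 0 := by
  obtain ⟨f, hf⟩ := hp.exists_affineMap
  have : f = 0 := AffineMap.ext_on (hU.affineSpan_eq_top hne) fun a ha => by
    rw [← hf, h a ha]; rfl
  funext x
  rw [hf, this]
  rfl

/-- The space of local polynomials. -/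
def localSpace (d : ℕ) (κ : FEKind) : Submodule ℝ (Field d κ) where
  carrier := {p | IsLocal κ p}
  -- The family `{∅}` is a dummy that serves to read off the local property.
  zero_mem' := (IsPiecewise.zero (T := {∅}) (F := ⟨κ, ∅⟩)).isLocal ∅ (by simp)
  add_mem' := by
    intro p q hp hq
    cases κ
    · obtain ⟨g, c, h1⟩ := hp
      obtain ⟨g', c', h2⟩ := hq
      refine ⟨g + g', c + c', fun x => ?_⟩
      simp only [Pi.add_apply, h1, h2]
      funext i
      simp only [Pi.add_apply, add_dotProduct]
      ring
    · obtain ⟨a, B, hB, h1⟩ := hp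
      obtain ⟨a', B', hB', h2⟩ := hq
      refine ⟨a + a', B + B', by rw [Matrix.transpose_add, hB, hB', neg_add], fun x => ?_⟩
      simp only [Pi.add_apply, h1, h2, Matrix.add_mulVec]
      exact add_add_add_comm _ _ _ _
    · obtain ⟨a, b, h1⟩ := hp
      obtain ⟨a', b', h2⟩ := hq
      refine ⟨a + a', b + b', fun x => ?_⟩
      simp only [Pi.add_apply, h1, h2, add_smul]
      exact add_add_add_comm _ _ _ _
  smul_mem' := by
    intro c p hp
    cases κ
    · obtain ⟨g, e, h1⟩ := hp
      refine ⟨c • g, c * e, fun x => ?_⟩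
      simp only [Pi.smul_apply, h1]
      funext i
      simp only [Pi.smul_apply, smul_dotProduct, smul_eq_mul]
      ring
    · obtain ⟨a, B, hB, h1⟩ := hp
      refine ⟨c • a, c • B, by rw [Matrix.transpose_smul, hB, smul_neg], fun x => ?_⟩
      simp only [Pi.smul_apply, h1, Matrix.smul_mulVec]
      exact smul_add _ _ _
    · obtain ⟨a, b, h1⟩ := hp
      refine ⟨c • a, c * b, fun x => ?_⟩
      simp only [Pi.smul_apply, h1, mul_smul]
      exact smul_add _ _ _

end Local

/-! ### Degrees of freedom -/

section Dof

variable {d : ℕ}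

/-- The degree of freedom of the subsimplex `σ`: the value at a vertex, the scaled tangential
component along an edge, the normal component on a face. -/
def dof (o : Orientation d) :
    (κ : FEKind) → (σ : Finset (Fin d → ℝ)) → Field d κ →ₗ[ℝ] ℝ
  | .S1, σ =>
    { toFun := fun p => ∑ a ∈ σ, p a (0 : Fin 1)
      map_add' := fun p q => Finset.sum_add_distrib
      map_smul' := fun c p => (Finset.mul_sum _ _ _).symm }
  | .N0, σ =>
    { toFun := fun p => (o.scale σ)⁻¹ * ((p (o.tail σ) : Fin d → ℝ) ⬝ᵥ (o.head σ - o.tail σ))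
      map_add' := fun p q => by
        rw [← mul_add]
        exact congrArg _ (add_dotProduct _ _ _)
      map_smul' := fun c p => by
        rw [RingHom.id_apply, smul_eq_mul, mul_left_comm]
        exact congrArg _ (smul_dotProduct c (p (o.tail σ) : Fin d → ℝ) _) }
  | .RT0, σ =>
    { toFun := fun p => (d : ℝ)⁻¹ * ∑ q ∈ σ, (p q : Fin d → ℝ) ⬝ᵥ o.normal σ
      map_add' := fun p q => by
        rw [← mul_add, ← Finset.sum_add_distrib]
        exact congrArg _ (Finset.sum_congr rfl fun _ _ => add_dotProduct _ _ _)
      map_smul' := fun c p => by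
        rw [RingHom.id_apply, smul_eq_mul, mul_left_comm]
        exact congrArg _ ((Finset.sum_congr rfl fun q _ =>
          smul_dotProduct c (p q : Fin d → ℝ) _).trans (Finset.mul_sum _ _ _).symm) }

theorem mem_subsimplices {T : Finset (Finset (Fin d → ℝ))} {n : ℕ} {σ : Finset (Fin d → ℝ)} :
    σ ∈ subsimplices T n ↔ ∃ K ∈ T, σ ⊆ K ∧ σ.card = n := by
  simp [subsimplices, Finset.mem_powersetCard]

theorem IsNormal.dotProduct_sub_eq_zero {f : Finset (Fin d → ℝ)} {ν : Fin d → ℝ}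
    (hν : IsNormal f ν) {a x : Fin d → ℝ} (ha : a ∈ f)
    (hx : x ∈ convexHull ℝ (f : Set (Fin d → ℝ))) : ν ⬝ᵥ (x - a) = 0 := by
  have hc : Convex ℝ {x | ν ⬝ᵥ (x - a) = 0} := by
    intro x hx y hy α β _ _ hαβ
    have hx' : ν ⬝ᵥ (x - a) = 0 := hx
    have hy' : ν ⬝ᵥ (y - a) = 0 := hy
    have h : α • x + β • y - a = α • (x - a) + β • (y - a) := by
      have : a = α • a + β • a := by rw [← add_smul, hαβ, one_smul]
      nth_rw 1 [this]
      simp only [smul_sub]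
      abel
    change ν ⬝ᵥ (α • x + β • y - a) = 0
    rw [h, dotProduct_add, dotProduct_smul, dotProduct_smul, hx', hy', smul_zero, smul_zero,
      add_zero]
  exact convexHull_min (fun b hb => hν b hb a ha) hc hx

theorem exists_sdiff_eq_singleton {K σ : Finset (Fin d → ℝ)} (hK : IsSimplex K) (hσ : σ ⊆ K)
    (hc : σ.card = d) [DecidableEq (Fin d → ℝ)] :
    ∃ a ∈ K, a ∉ σ ∧ K \ σ = {a} ∧ ∀ b ∈ K, b ≠ a → b ∈ σ := by
  have h1 : (K \ σ).card = 1 := by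
    rw [Finset.card_sdiff_of_subset hσ, hK.card_eq, hc]
    simp
  obtain ⟨a, ha⟩ := Finset.card_eq_one.1 h1
  have ha' : a ∈ K \ σ := by rw [ha]; exact Finset.mem_singleton_self a
  rw [Finset.mem_sdiff] at ha'
  refine ⟨a, ha'.1, ha'.2, ha, fun b hb hba => ?_⟩
  by_contra hbσ
  have : b ∈ K \ σ := Finset.mem_sdiff.2 ⟨hb, hbσ⟩
  rw [ha, Finset.mem_singleton] at this
  exact hba this

/-- The component of the opposite vertex in the direction of a nonzero normal vector. -/
theorem IsSimplex.exists_height {K σ : Finset (Fin d → ℝ)} (hK : IsSimplex K) {a : Fin d → ℝ}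
    (hσ : ∀ b ∈ K, b ≠ a → b ∈ σ) {ν : Fin d → ℝ}
    (hν : IsNormal σ ν) (hν0 : ν ≠ 0) :
    ∃ h : ℝ, h ≠ 0 ∧ ∀ q ∈ σ, ν ⬝ᵥ (q - a) = h := by
  have hne : ∃ q ∈ K, ν ⬝ᵥ (q - a) ≠ 0 := by
    by_contra hcon
    push Not at hcon
    exact hν0 (hK.eq_zero_of_dotProduct hcon)
  obtain ⟨q, hq, hqa⟩ := hne
  have hqσ : q ∈ σ := hσ q hq (by rintro rfl; simp at hqa)
  refine ⟨_, hqa, fun r hr => ?_⟩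
  have := hν r hr q hqσ
  rw [← sub_add_sub_cancel r q a, dotProduct_add, this, zero_add]

/-- Any two normal vectors of a face are parallel. -/
theorem IsSimplex.exists_eq_smul_normal {K σ : Finset (Fin d → ℝ)} (hK : IsSimplex K)
    {a : Fin d → ℝ} (hσ : ∀ b ∈ K, b ≠ a → b ∈ σ) {ν ν' : Fin d → ℝ}
    (hν : IsNormal σ ν) (hν0 : ν ≠ 0) (hν' : IsNormal σ ν') : ∃ t : ℝ, ν' = t • ν := by
  by_cases h0 : ν' = 0
  · exact ⟨0, by rw [h0, zero_smul]⟩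
  obtain ⟨h, hh, hh'⟩ := hK.exists_height hσ hν hν0
  obtain ⟨h2, -, hh2'⟩ := hK.exists_height hσ hν' h0
  refine ⟨h2 / h, sub_eq_zero.1 (hK.eq_zero_of_dotProduct (a := a) fun b hb => ?_)⟩
  by_cases hba : b = a
  · simp [hba]
  · have hbσ := hσ b hb hba
    rw [sub_dotProduct, smul_dotProduct, hh' b hbσ, hh2' b hbσ, smul_eq_mul, div_mul_cancel₀ _ hh,
      sub_self]

theorem IsSimplex.bary_eq_zero {K : Finset (Fin d → ℝ)} (hK : IsSimplex K) {a : Fin d → ℝ}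
    (ha : a ∉ K) : bary K a = 0 :=
  hK.affineMap_ext fun _ hb => hK.bary_of_ne hb fun h => ha (h ▸ hb)

theorem grad_zero : grad (0 : (Fin d → ℝ) →ᵃ[ℝ] ℝ) = 0 := by
  funext i
  simp [grad]

variable {o : Orientation d} {T : Finset (Finset (Fin d → ℝ))}

theorem Orientation.IsFor.tail_mem (ho : o.IsFor T) {σ : Finset (Fin d → ℝ)}
    (hσ : σ ∈ subsimplices T 2) : o.tail σ ∈ σ := by
  classical
  have h : o.tail σ ∈ ({o.tail σ, o.head σ} : Finset (Fin d → ℝ)) := by simp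
  convert! h
  convert! ho.edge σ hσ

theorem Orientation.IsFor.head_mem (ho : o.IsFor T) {σ : Finset (Fin d → ℝ)}
    (hσ : σ ∈ subsimplices T 2) : o.head σ ∈ σ := by
  classical
  have h : o.head σ ∈ ({o.tail σ, o.head σ} : Finset (Fin d → ℝ)) := by simp
  convert! h
  convert! ho.edge σ hσ

theorem Orientation.IsFor.eq_tail_or_head (ho : o.IsFor T) {σ : Finset (Fin d → ℝ)}
    (hσ : σ ∈ subsimplices T 2) {v : Fin d → ℝ} (hv : v ∈ σ) : v = o.tail σ ∨ v = o.head σ := by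
  classical
  have h := ho.edge σ hσ
  rw [h] at hv
  simpa using hv

theorem Orientation.IsFor.tail_ne_head (ho : o.IsFor T) {σ : Finset (Fin d → ℝ)}
    (hσ : σ ∈ subsimplices T 2) : o.tail σ ≠ o.head σ := by
  intro h
  obtain ⟨K, -, -, hc⟩ := mem_subsimplices.1 hσ
  have := Finset.card_le_one.2 fun a ha b hb => by
    rcases ho.eq_tail_or_head hσ ha with rfl | rfl <;>
      rcases ho.eq_tail_or_head hσ hb with rfl | rfl <;> simp [h]
  omega

/-- Tested with `y - x`, a gradient becomes a difference of values, and the tangential component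
turns into a 2×2 determinant of barycentric coordinates. Tangential continuity and vanishing traces
then follow from the behaviour of barycentric coordinates on subsimplices. -/
theorem localShape_N0_dotProduct (K σ : Finset (Fin d → ℝ)) (x y : Fin d → ℝ) :
    (localShape o .N0 K σ x : Fin d → ℝ) ⬝ᵥ (y - x) =
      o.scale σ * (bary K (o.tail σ) x * bary K (o.head σ) y -
        bary K (o.head σ) x * bary K (o.tail σ) y) := by
  change (o.scale σ • (bary K (o.tail σ) x • grad (bary K (o.head σ)) -
      bary K (o.head σ) x • grad (bary K (o.tail σ))) : Fin d → ℝ) ⬝ᵥ (y - x) = _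
  rw [smul_dotProduct, sub_dotProduct, smul_dotProduct, smul_dotProduct, grad_dotProduct_sub,
    grad_dotProduct_sub]
  simp only [smul_eq_mul]
  ring

/-- The tangential components of the shape function of an edge vanish on the subsimplices that do
not contain the edge. -/
theorem localShape_N0_dotProduct_eq_zero (ho : o.IsFor T) {K σ τ : Finset (Fin d → ℝ)}
    (hK : IsSimplex K) (hσ : σ ∈ subsimplices T 2) (hτ : τ ⊆ K) (hστ : ¬ σ ⊆ τ)
    {x y : Fin d → ℝ} (hx : x ∈ convexHull ℝ (τ : Set (Fin d → ℝ)))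
    (hy : y ∈ convexHull ℝ (τ : Set (Fin d → ℝ))) :
    (localShape o .N0 K σ x : Fin d → ℝ) ⬝ᵥ (y - x) = 0 := by
  obtain ⟨v, hv, hvτ⟩ := Finset.not_subset.1 hστ
  have hτ' : (τ : Set (Fin d → ℝ)) ⊆ K := hτ
  have hvτ' : v ∉ (τ : Set (Fin d → ℝ)) := hvτ
  have h1 := hK.bary_eq_zero_of_notMem hτ' hvτ' hx
  have h2 := hK.bary_eq_zero_of_notMem hτ' hvτ' hy
  rw [localShape_N0_dotProduct]
  rcases ho.eq_tail_or_head hσ hv with h | h <;> simp [← h, h1, h2]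

/-- The sum in `localShape` has one term, for the vertex `a` opposite to the face, and the `d`
summands of the denominator all equal the height `h`. -/
theorem localShape_RT0_apply (ho : o.IsFor T) {K σ : Finset (Fin d → ℝ)} (hK : IsSimplex K)
    (hσK : σ ⊆ K) (hσ : σ ∈ subsimplices T d) (hc : σ.card = d) (hd : d ≠ 0) :
    ∃ a ∈ K, a ∉ σ ∧ (∀ b ∈ K, b ≠ a → b ∈ σ) ∧ ∃ h : ℝ, h ≠ 0 ∧
      (∀ q ∈ σ, o.normal σ ⬝ᵥ (q - a) = h) ∧
      ∀ x, (localShape o .RT0 K σ x : Fin d → ℝ) = h⁻¹ • (x - a) := by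
  classical
  obtain ⟨a, haK, haσ, hd1, hall⟩ := exists_sdiff_eq_singleton hK hσK hc
  obtain ⟨h, hh, hq⟩ := hK.exists_height hall (ho.isNormal σ hσ) (ho.normal_ne_zero σ hσ)
  refine ⟨a, haK, haσ, hall, h, hh, hq, fun x => ?_⟩
  have hd' : (d : ℝ) ≠ 0 := Nat.cast_ne_zero.2 hd
  change (∑ a ∈ _, ((d : ℝ) / ∑ q ∈ σ, o.normal σ ⬝ᵥ (q - a)) • (x - a) : Fin d → ℝ) = _
  refine (Finset.sum_congr (s₂ := {a}) (by rw [← hd1]) fun _ _ => rfl).trans ?_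
  rw [Finset.sum_singleton, Finset.sum_congr rfl hq, Finset.sum_const, hc, nsmul_eq_mul,
    div_mul_eq_div_div, div_self hd', one_div]

/-- Every other face contains the vertex `a` opposite to `σ`, so `x - a` is tangential to it. -/
theorem localShape_RT0_dotProduct_eq_zero (ho : o.IsFor T) {K σ f : Finset (Fin d → ℝ)}
    (hK : IsSimplex K) (hσK : σ ⊆ K) (hσ : σ ∈ subsimplices T d) (hc : σ.card = d) (hd : d ≠ 0)
    (hf : f ⊆ K) (hfc : f.card = d) (hne : f ≠ σ) {ν : Fin d → ℝ} (hν : IsNormal f ν)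
    {x : Fin d → ℝ} (hx : x ∈ convexHull ℝ (f : Set (Fin d → ℝ))) :
    (localShape o .RT0 K σ x : Fin d → ℝ) ⬝ᵥ ν = 0 := by
  obtain ⟨a, haK, haσ, hall, h, -, -, hx'⟩ := localShape_RT0_apply ho hK hσK hσ hc hd
  have haf : a ∈ f := by
    by_contra haf
    refine hne (Finset.eq_of_subset_of_card_le (fun b hb => hall b (hf hb) ?_) (by omega))
    rintro rfl
    exact haf hb
  refine (congrArg (fun u : Fin d → ℝ => u ⬝ᵥ ν) (hx' x)).trans ?_
  rw [smul_dotProduct, dotProduct_comm, hν.dotProduct_sub_eq_zero haf hx, smul_zero]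

theorem localShape_RT0_dotProduct_normal (ho : o.IsFor T) {K σ : Finset (Fin d → ℝ)}
    (hK : IsSimplex K) (hσK : σ ⊆ K) (hσ : σ ∈ subsimplices T d) (hc : σ.card = d) (hd : d ≠ 0)
    {x : Fin d → ℝ} (hx : x ∈ convexHull ℝ (σ : Set (Fin d → ℝ))) :
    (localShape o .RT0 K σ x : Fin d → ℝ) ⬝ᵥ o.normal σ = 1 := by
  obtain ⟨a, haK, haσ, hall, h, hh, hq, hx'⟩ := localShape_RT0_apply ho hK hσK hσ hc hd
  obtain ⟨q, hqσ⟩ : σ.Nonempty := Finset.card_pos.1 (by omega)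
  have h1 := (ho.isNormal σ hσ).dotProduct_sub_eq_zero hqσ hx
  have h2 := hq q hqσ
  refine (congrArg (fun u : Fin d → ℝ => u ⬝ᵥ o.normal σ) (hx' x)).trans ?_
  rw [smul_dotProduct, dotProduct_comm, ← sub_add_sub_cancel x q a, dotProduct_add, h1, h2,
    zero_add, smul_eq_mul, inv_mul_cancel₀ hh]

theorem isLocal_localShape (κ : FEKind) (K σ : Finset (Fin d → ℝ)) :
    IsLocal κ (localShape o κ K σ) := by
  classical
  cases κ
  · refine ⟨∑ a ∈ σ, grad (bary K a), ∑ a ∈ σ, bary K a 0, fun x => ?_⟩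
    funext i
    rw [sum_dotProduct, ← Finset.sum_add_distrib]
    exact Finset.sum_congr rfl fun a _ => apply_eq_grad_dotProduct_add _ _
  · set u := grad (bary K (o.tail σ)) with hu
    set v := grad (bary K (o.head σ)) with hv
    -- Inserting `λ(x) = ∇λ · x + λ(0)` into the Whitney function leaves the antisymmetric rank-two
    -- matrix `v uᵀ - u vᵀ` as linear part.
    refine ⟨o.scale σ • (bary K (o.tail σ) 0 • v - bary K (o.head σ) 0 • u),
      o.scale σ • (Matrix.vecMulVec v u - Matrix.vecMulVec u v), ?_, fun x => ?_⟩
    · rw [Matrix.transpose_smul, Matrix.transpose_sub, Matrix.transpose_vecMulVec,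
        Matrix.transpose_vecMulVec, ← smul_neg, neg_sub]
    · change (o.scale σ • (bary K (o.tail σ) x • v - bary K (o.head σ) x • u) : Fin d → ℝ) = _
      rw [apply_eq_grad_dotProduct_add _ x, apply_eq_grad_dotProduct_add (bary K (o.head σ)) x,
        Matrix.smul_mulVec, Matrix.sub_mulVec, Matrix.vecMulVec_mulVec, Matrix.vecMulVec_mulVec,
        ← smul_add, ← hu, ← hv]
      congr 1
      simp only [add_smul, op_smul_eq_smul]
      abel
  · refine ⟨-∑ a ∈ K \ σ, ((d : ℝ) / ∑ q ∈ σ, o.normal σ ⬝ᵥ (q - a)) • a,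
      ∑ a ∈ K \ σ, ((d : ℝ) / ∑ q ∈ σ, o.normal σ ⬝ᵥ (q - a)), fun x => ?_⟩
    unfold localShape
    simp only [smul_sub, Finset.sum_sub_distrib, Finset.sum_smul]
    rw [sub_eq_neg_add]

open Classical in
/-- The shape functions are dual to the degrees of freedom. -/
theorem dof_localShape (ho : o.IsFor T) (hd : d ≠ 0) (κ : FEKind) {K : Finset (Fin d → ℝ)}
    (hKT : K ∈ T) (hK : IsSimplex K) {σ σ' : Finset (Fin d → ℝ)} (hσ : σ ⊆ K)
    (hc : σ.card = κ.numVertices d) (hσ' : σ' ⊆ K) (hc' : σ'.card = κ.numVertices d) :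
    dof o κ σ' (localShape o κ K σ) = if σ' = σ then 1 else 0 := by
  have hsub : σ ∈ subsimplices T (κ.numVertices d) := mem_subsimplices.2 ⟨K, hKT, hσ, hc⟩
  have hsub' : σ' ∈ subsimplices T (κ.numVertices d) := mem_subsimplices.2 ⟨K, hKT, hσ', hc'⟩
  cases κ
  · obtain ⟨a, rfl⟩ := Finset.card_eq_one.1 hc
    obtain ⟨b, rfl⟩ := Finset.card_eq_one.1 hc'
    change ∑ c ∈ {b}, ∑ a ∈ {a}, bary K a c = _
    rw [Finset.sum_singleton, Finset.sum_singleton, hK.bary_apply a (by simpa using hσ')]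
    simp
  · change (o.scale σ')⁻¹ *
      ((localShape o .N0 K σ (o.tail σ') : Fin d → ℝ) ⬝ᵥ (o.head σ' - o.tail σ')) = _
    have ht := ho.tail_mem hsub'
    have hh := ho.head_mem hsub'
    split_ifs with h
    · subst h
      rw [localShape_N0_dotProduct, hK.bary_self (hσ' ht), hK.bary_self (hσ' hh),
        hK.bary_of_ne (hσ' ht) (ho.tail_ne_head hsub')]
      have := ho.scale_ne_zero σ' hsub'
      field_simp
      simp
    · rw [localShape_N0_dotProduct_eq_zero ho hK hsub hσ' (fun hcon => h
        (Finset.eq_of_subset_of_card_le hcon (by omega)).symm) (subset_convexHull ℝ _ ht)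
        (subset_convexHull ℝ _ hh), mul_zero]
  · change (d : ℝ)⁻¹ * ∑ q ∈ σ', (localShape o .RT0 K σ q : Fin d → ℝ) ⬝ᵥ o.normal σ' = _
    have hd' : (d : ℝ) ≠ 0 := Nat.cast_ne_zero.2 hd
    split_ifs with h
    · subst h
      rw [Finset.sum_congr rfl fun q hq => localShape_RT0_dotProduct_normal ho hK hσ hsub hc hd
        (subset_convexHull ℝ _ hq), Finset.sum_const, hc]
      simp [FEKind.numVertices, hd']
    · rw [Finset.sum_eq_zero fun q hq => localShape_RT0_dotProduct_eq_zero ho hK hσ hsub hc hd hσ'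
        hc' h (ho.isNormal σ' hsub') (subset_convexHull ℝ _ hq), mul_zero]

/-- Each functional evaluates only the trace that conformity makes single-valued; this is why the
coefficient of a shape function does not depend on the simplex where it is computed. -/
theorem TraceEq.dof_eq (ho : o.IsFor T) {κ : FEKind} {K K' : Finset (Fin d → ℝ)} (hKT : K ∈ T)
    {p q : Field d κ} (h : TraceEq κ K K' p q) {σ : Finset (Fin d → ℝ)} (hσ : σ ⊆ K)
    (hσ' : σ ⊆ K') (hc : σ.card = κ.numVertices d) : dof o κ σ p = dof o κ σ q := by
  have hsub : σ ∈ subsimplices T (κ.numVertices d) := mem_subsimplices.2 ⟨K, hKT, hσ, hc⟩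
  have hmem : ∀ a ∈ σ, a ∈ convexHull ℝ (K : Set (Fin d → ℝ)) ∩
      convexHull ℝ (K' : Set (Fin d → ℝ)) := fun a ha =>
    ⟨subset_convexHull ℝ _ (hσ ha), subset_convexHull ℝ _ (hσ' ha)⟩
  cases κ
  · exact Finset.sum_congr rfl fun a ha => congrFun (h a (hmem a ha)) (0 : Fin 1)
  · exact congrArg ((o.scale σ)⁻¹ * ·) (h _ (hmem _ (ho.tail_mem hsub)) _
      (hmem _ (ho.head_mem hsub)))
  · exact congrArg ((d : ℝ)⁻¹ * ·) (Finset.sum_congr rfl fun a ha =>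
      h σ hσ hσ' hc _ (ho.isNormal σ hsub) a (subset_convexHull ℝ _ ha))

theorem ZeroTrace.dof_eq_zero (ho : o.IsFor T) {κ : FEKind} {Γ : Set (Fin d → ℝ)}
    {K : Finset (Fin d → ℝ)} (hKT : K ∈ T) {p : Field d κ} (h : ZeroTrace Γ κ K p)
    {σ : Finset (Fin d → ℝ)} (hσ : σ ⊆ K) (hc : σ.card = κ.numVertices d)
    (hΓ : convexHull ℝ (σ : Set (Fin d → ℝ)) ⊆ Γ) : dof o κ σ p = 0 := by
  have hsub : σ ∈ subsimplices T (κ.numVertices d) := mem_subsimplices.2 ⟨K, hKT, hσ, hc⟩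
  have hmem : ∀ a ∈ σ, a ∈ convexHull ℝ (σ : Set (Fin d → ℝ)) := fun a ha =>
    subset_convexHull ℝ _ ha
  cases κ
  · exact Finset.sum_eq_zero fun a ha =>
      congrFun (h a ⟨subset_convexHull ℝ _ (hσ ha), hΓ (hmem a ha)⟩) (0 : Fin 1)
  · exact (congrArg ((o.scale σ)⁻¹ * ·) (h σ hσ hΓ _ (hmem _ (ho.tail_mem hsub)) _
      (hmem _ (ho.head_mem hsub)))).trans (mul_zero _)
  · exact (congrArg ((d : ℝ)⁻¹ * ·) (Finset.sum_eq_zero fun a ha =>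
      h σ hσ hc hΓ _ (ho.isNormal σ hsub) a (hmem a ha))).trans (mul_zero _)

/-- Since `B` is skew-symmetric, `p y - p x` is orthogonal to `y - x`, so the tangential component
along an edge is the same at both ends and the orientation is irrelevant. The edges at `a` then make
`p a` orthogonal to a spanning set. -/
theorem eq_zero_of_edge_dof (ho : o.IsFor T) {K : Finset (Fin d → ℝ)} (hKT : K ∈ T)
    (hK : IsSimplex K) {p : (Fin d → ℝ) → (Fin d → ℝ)} {α : Fin d → ℝ}
    {B : Matrix (Fin d) (Fin d) ℝ} (hB : Bᵀ = -B) (hp : ∀ x, p x = α + B *ᵥ x)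
    (h : ∀ σ ⊆ K, σ.card = 2 →
      (o.scale σ)⁻¹ * (p (o.tail σ) ⬝ᵥ (o.head σ - o.tail σ)) = 0)
    {a : Fin d → ℝ} (ha : a ∈ K) : p a = 0 := by
  classical
  have hskew : ∀ x : Fin d → ℝ, (B *ᵥ x) ⬝ᵥ x = 0 := by
    intro x
    have h1 : (B *ᵥ x) ⬝ᵥ x = (Bᵀ *ᵥ x) ⬝ᵥ x := by
      rw [dotProduct_comm, Matrix.dotProduct_mulVec, Matrix.mulVec_transpose]
    rw [hB, Matrix.neg_mulVec, neg_dotProduct] at h1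
    linarith
  have hanti : ∀ x y : Fin d → ℝ,
      p x ⬝ᵥ (y - x) + p y ⬝ᵥ (x - y) = 0 := by
    intro x y
    have h1 := hskew (y - x)
    rw [hp x, hp y, ← neg_sub y x, dotProduct_neg, ← sub_eq_add_neg, ← sub_dotProduct,
      add_sub_add_left_eq_sub, ← Matrix.mulVec_sub, ← neg_sub y x, Matrix.mulVec_neg,
      neg_dotProduct, h1, neg_zero]
  refine hK.eq_zero_of_dotProduct (a := a) fun b hb => ?_
  by_cases hba : b = a
  · rw [hba, sub_self]
    exact dotProduct_zero _
  have hsubK : ({a, b} : Finset (Fin d → ℝ)) ⊆ K := by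
    simp [Finset.insert_subset_iff, ha, hb]
  have hc : ({a, b} : Finset (Fin d → ℝ)).card = 2 := Finset.card_pair (Ne.symm hba)
  have hsub : ({a, b} : Finset (Fin d → ℝ)) ∈ subsimplices T 2 :=
    mem_subsimplices.2 ⟨K, hKT, hsubK, hc⟩
  have h0 := h {a, b} hsubK hc
  rw [mul_eq_zero, or_iff_right (inv_ne_zero (ho.scale_ne_zero _ hsub))] at h0
  have hne := ho.tail_ne_head hsub
  have ht := ho.tail_mem hsub
  have hh := ho.head_mem hsub
  simp only [Finset.mem_insert, Finset.mem_singleton] at ht hh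
  rcases ht with ht | ht <;> rcases hh with hh | hh
  · exact absurd (ht.trans hh.symm) hne
  · rwa [ht, hh] at h0
  · rw [ht, hh] at h0
    have := hanti a b
    rw [h0, add_zero] at this
    exact this
  · exact absurd (ht.trans hh.symm) hne

/-- The field `α + β x` has constant normal component on a face, because `x · ν` is constant there.
A normal of the face opposite to `b` is `∇λ_b`, so the faces through `a` give `∇λ_b · p a = 0` for
all `b ≠ a`. -/
theorem eq_zero_of_face_dof (ho : o.IsFor T) (hd : d ≠ 0) {K : Finset (Fin d → ℝ)} (hKT : K ∈ T)
    (hK : IsSimplex K) {p : (Fin d → ℝ) → (Fin d → ℝ)} {α : Fin d → ℝ} {β : ℝ}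
    (hp : ∀ x, p x = α + β • x)
    (h : ∀ σ ⊆ K, σ.card = d → (d : ℝ)⁻¹ * ∑ q ∈ σ, p q ⬝ᵥ o.normal σ = 0)
    {a : Fin d → ℝ} (ha : a ∈ K) : p a = 0 := by
  classical
  have key : ∀ b ∈ K, b ≠ a → grad (bary K b) ⬝ᵥ p a = 0 := by
    intro b hb hba
    have hσK : K.erase b ⊆ K := Finset.erase_subset b K
    have hc : (K.erase b).card = d := by rw [Finset.card_erase_of_mem hb, hK.card_eq]; simp
    have hsub : K.erase b ∈ subsimplices T d := mem_subsimplices.2 ⟨K, hKT, hσK, hc⟩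
    have haσ : a ∈ K.erase b := Finset.mem_erase.2 ⟨Ne.symm hba, ha⟩
    have hall : ∀ c ∈ K, c ≠ b → c ∈ K.erase b := fun c hc hcb => Finset.mem_erase.2 ⟨hcb, hc⟩
    have hν := ho.isNormal _ hsub
    have hgrad : IsNormal (K.erase b) (grad (bary K b)) := by
      intro x hx y hy
      rw [grad_dotProduct_sub, hK.bary_of_ne (hσK hx) (Finset.ne_of_mem_erase hx),
        hK.bary_of_ne (hσK hy) (Finset.ne_of_mem_erase hy), sub_zero]
    obtain ⟨t, ht⟩ := hK.exists_eq_smul_normal hall hν (ho.normal_ne_zero _ hsub) hgrad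
    have h0 := h _ hσK hc
    have hconst : ∀ q ∈ K.erase b, p q ⬝ᵥ o.normal (K.erase b) =
        p a ⬝ᵥ o.normal (K.erase b) := by
      intro q hq
      have h1 := hν q hq a haσ
      rw [dotProduct_sub, sub_eq_zero] at h1
      rw [hp, hp, add_dotProduct, add_dotProduct, smul_dotProduct, smul_dotProduct,
        dotProduct_comm q, dotProduct_comm a, h1]
    have hd' : (d : ℝ) ≠ 0 := Nat.cast_ne_zero.2 hd
    rw [Finset.sum_congr rfl hconst, Finset.sum_const, hc, nsmul_eq_mul, ← mul_assoc,
      inv_mul_cancel₀ hd', one_mul] at h0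
    rw [ht, smul_dotProduct, dotProduct_comm, h0, smul_zero]
  -- The missing case `b = a` follows because the gradients of all barycentric coordinates sum to
  -- zero.
  refine hK.eq_zero_of_grad_dotProduct fun b hb => ?_
  by_cases hba : b = a
  · have hsum := congrArg (· ⬝ᵥ p a) hK.sum_grad_bary
    simp only [sum_dotProduct, zero_dotProduct] at hsum
    rw [Finset.sum_eq_single_of_mem b hb fun c hc hcb => key c hc (hba ▸ hcb)] at hsum
    exact hsum
  · exact key b hb hba

/-- A local polynomial is determined by its degrees of freedom. -/
theorem IsLocal.eq_zero_of_dof (ho : o.IsFor T) (hd : d ≠ 0) {κ : FEKind}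
    {K : Finset (Fin d → ℝ)} (hKT : K ∈ T) (hK : IsSimplex K) {p : Field d κ} (hp : IsLocal κ p)
    (h : ∀ σ ⊆ K, σ.card = κ.numVertices d → dof o κ σ p = 0) : p = 0 := by
  classical
  refine hp.eq_zero_of_vertices hK fun a ha => ?_
  cases κ
  · have : ∑ c ∈ {a}, p c (0 : Fin 1) = 0 :=
      h {a} (by simpa using ha) (by simp [FEKind.numVertices])
    rw [Finset.sum_singleton] at this
    funext i
    exact (congrArg (p a) (Subsingleton.elim (α := Fin 1) i 0)).trans this
  · obtain ⟨α, B, hB, hp⟩ := hp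
    exact eq_zero_of_edge_dof ho hKT hK hB hp h ha
  · obtain ⟨α, β, hp⟩ := hp
    exact eq_zero_of_face_dof ho hd hKT hK hp h ha

end Dof

/-! ### Shape functions are a basis -/

section Basis

variable {d : ℕ} {D : Set (Fin d → ℝ)} {T : Finset (Finset (Fin d → ℝ))} {o : Orientation d}

/-- The boundary conditions that are compatible with the triangulation. For `S1`, the hat function
of a vertex outside of the boundary part has to vanish on the boundary part. -/
structure Factor.IsCompatible (T : Finset (Finset (Fin d → ℝ))) (F : Factor d) : Prop where
  bary_eq_zero : F.kind = .S1 → ∀ K ∈ T, ∀ a ∈ K, a ∉ F.bdry →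
    ∀ x ∈ convexHull ℝ (K : Set (Fin d → ℝ)) ∩ F.bdry, bary K a x = 0
  bdry_eq_empty : F.kind = .RT0 → F.bdry = ∅

open Classical in
/-- The restriction to `K` of the shape function of `σ`, extended to a polynomial on `ℝ^d`. -/
def shapePiece (o : Orientation d) (κ : FEKind) (σ K : Finset (Fin d → ℝ)) : Field d κ :=
  if σ ⊆ K then localShape o κ K σ else 0

theorem shapePiece_of_subset {κ : FEKind} {σ K : Finset (Fin d → ℝ)} (h : σ ⊆ K) :
    shapePiece o κ σ K = localShape o κ K σ := if_pos h

theorem shapePiece_of_not_subset {κ : FEKind} {σ K : Finset (Fin d → ℝ)} (h : ¬ σ ⊆ K) :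
    shapePiece o κ σ K = 0 := if_neg h

/-- Off the star of `σ` the formula already gives zero, so traces on neighbouring simplices can be
compared without distinguishing whether they contain `σ`. -/
theorem shapePiece_S1 {K σ : Finset (Fin d → ℝ)} (hK : IsSimplex K) (hc : σ.card = 1) :
    shapePiece o .S1 σ K = localShape o .S1 K σ := by
  by_cases h : σ ⊆ K
  · exact shapePiece_of_subset h
  · obtain ⟨a, rfl⟩ := Finset.card_eq_one.1 hc
    rw [shapePiece_of_not_subset h]
    have ha : a ∉ K := by simpa using h
    funext x i
    change (0 : ℝ) = ∑ a ∈ {a}, bary K a x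
    rw [Finset.sum_singleton, hK.bary_eq_zero ha]
    rfl

theorem shapePiece_N0 (ho : o.IsFor T) {K σ : Finset (Fin d → ℝ)} (hK : IsSimplex K)
    (hσ : σ ∈ subsimplices T 2) : shapePiece o .N0 σ K = localShape o .N0 K σ := by
  by_cases h : σ ⊆ K
  · exact shapePiece_of_subset h
  · obtain ⟨v, hv, hvK⟩ := Finset.not_subset.1 h
    rw [shapePiece_of_not_subset h]
    funext x
    change (0 : Fin d → ℝ) = (o.scale σ • (bary K (o.tail σ) x • grad (bary K (o.head σ)) -
      bary K (o.head σ) x • grad (bary K (o.tail σ))) : Fin d → ℝ)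
    have h0 := hK.bary_eq_zero hvK
    rcases ho.eq_tail_or_head hσ hv with h | h <;> simp [← h, h0, grad_zero]

theorem isLocal_shapePiece (κ : FEKind) (σ K : Finset (Fin d → ℝ)) :
    IsLocal κ (shapePiece o κ σ K) := by
  unfold shapePiece
  split_ifs
  · exact isLocal_localShape κ K σ
  · exact (localSpace d κ).zero_mem

theorem shapePiece_RT0_dotProduct_eq_zero (ho : o.IsFor T) (hd : d ≠ 0)
    {K σ f : Finset (Fin d → ℝ)} (hK : IsSimplex K) (hσ : σ ∈ subsimplices T d)
    (hc : σ.card = d) (hf : f ⊆ K) (hfc : f.card = d) (hne : f ≠ σ) {ν : Fin d → ℝ}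
    (hν : IsNormal f ν) {x : Fin d → ℝ} (hx : x ∈ convexHull ℝ (f : Set (Fin d → ℝ))) :
    (shapePiece o .RT0 σ K x : Fin d → ℝ) ⬝ᵥ ν = 0 := by
  by_cases h : σ ⊆ K
  · rw [shapePiece_of_subset h]
    exact localShape_RT0_dotProduct_eq_zero ho hK h hσ hc hd hf hfc hne hν hx
  · rw [shapePiece_of_not_subset h]
    exact zero_dotProduct _

/-- For `S1` and `N0` the traces are expressions in barycentric coordinates, which agree on common
subsimplices. For `RT0` the normal component is zero on all faces but `σ`, where the chosen normal
fixes it to be `1` from both sides. An `N0` boundary subsimplex cannot contain `σ`, since `σ` itself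
is not inside the boundary part. -/
theorem isPiecewise_shapePiece (hT : IsRegularTriangulation D T) (ho : o.IsFor T) (hd : d ≠ 0)
    {F : Factor d} (hF : F.IsCompatible T) {σ : Finset (Fin d → ℝ)} (hσ : σ ∈ indexSet T F) :
    IsPiecewise T F (shapePiece o F.kind σ) := by
  classical
  obtain ⟨κ, Γ⟩ := F
  obtain ⟨hsub, hΓ⟩ : σ ∈ subsimplices T (κ.numVertices d) ∧
      ¬ convexHull ℝ (σ : Set (Fin d → ℝ)) ⊆ Γ := by simpa [indexSet] using hσ
  have hc : σ.card = κ.numVertices d := (mem_subsimplices.1 hsub).choose_spec.2.2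
  refine ⟨fun K _ => isLocal_shapePiece κ σ K, fun K hK K' hK' => ?_, fun K hK => ?_⟩
  · have hKs := hT.isSimplex hK
    have hKs' := hT.isSimplex hK'
    have hb : ∀ a : Fin d → ℝ, ∀ x ∈ convexHull ℝ (K : Set (Fin d → ℝ)) ∩
        convexHull ℝ (K' : Set (Fin d → ℝ)), bary K a x = bary K' a x := fun a x hx =>
      hKs.bary_eq_bary hKs' Set.inter_subset_left Set.inter_subset_right a
        (hT.inter_subset hK hK' hx)
    cases κ
    · intro x hx
      dsimp only
      rw [shapePiece_S1 hKs hc, shapePiece_S1 hKs' hc]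
      funext i
      exact Finset.sum_congr rfl fun a _ => hb a x hx
    · intro x hx y hy
      dsimp only
      rw [shapePiece_N0 ho hKs hsub, shapePiece_N0 ho hKs' hsub]
      refine (localShape_N0_dotProduct K σ x y).trans
        (Eq.trans ?_ (localShape_N0_dotProduct K' σ x y).symm)
      rw [hb _ x hx, hb _ x hx, hb _ y hy, hb _ y hy]
    · intro f hf hf' hfc ν hν x hx
      by_cases hfσ : f = σ
      · subst hfσ
        dsimp only
        rw [shapePiece_of_subset hf, shapePiece_of_subset hf']
        obtain ⟨a, -, -, -, hall⟩ := exists_sdiff_eq_singleton hKs hf hc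
        obtain ⟨t, rfl⟩ := hKs.exists_eq_smul_normal hall (ho.isNormal f hsub)
          (ho.normal_ne_zero f hsub) hν
        refine (dotProduct_smul t (localShape o .RT0 K f x : Fin d → ℝ) _).trans
          (Eq.trans ?_ (dotProduct_smul t (localShape o .RT0 K' f x : Fin d → ℝ) _).symm)
        exact congrArg (t • ·) ((localShape_RT0_dotProduct_normal ho hKs hf hsub hc hd hx).trans
          (localShape_RT0_dotProduct_normal ho hKs' hf' hsub hc hd hx).symm)
      · exact (shapePiece_RT0_dotProduct_eq_zero ho hd hKs hsub hc hf hfc hfσ hν hx).trans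
          (shapePiece_RT0_dotProduct_eq_zero ho hd hKs' hsub hc hf' hfc hfσ hν hx).symm
  · have hKs := hT.isSimplex hK
    cases κ
    · intro x hx
      dsimp only
      by_cases h : σ ⊆ K
      · rw [shapePiece_S1 hKs hc]
        obtain ⟨a, rfl⟩ := Finset.card_eq_one.1 hc
        funext i
        change ∑ a ∈ {a}, bary K a x = 0
        rw [Finset.sum_singleton]
        exact hF.bary_eq_zero rfl K hK a (by simpa using h) (by simpa using hΓ) x hx
      · rw [shapePiece_of_not_subset h]
        rfl
    · intro τ hτ hτΓ x hx y hy
      dsimp only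
      rw [shapePiece_N0 ho hKs hsub]
      exact localShape_N0_dotProduct_eq_zero ho hKs hsub hτ
        (fun h => hΓ ((convexHull_mono h).trans hτΓ)) hx hy
    · intro f _ _ hfΓ ν _ x hx
      have : Γ = ∅ := hF.bdry_eq_empty rfl
      exact absurd (hfΓ hx) (by simp [this])

/-- Families of local polynomials with single-valued traces and with the boundary condition. -/
def piecewiseSpace (T : Finset (Finset (Fin d → ℝ))) (F : Factor d) :
    Submodule ℝ (Finset (Fin d → ℝ) → Field d F.kind) where
  carrier := {p | IsPiecewise T F p}
  zero_mem' := IsPiecewise.zero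
  add_mem' := fun hp hq => hp.add hq
  smul_mem' := fun c _ hp => hp.smul c

/-- The restrictions to the simplices of a linear combination of the shape functions. -/
def pieceSum (o : Orientation d) (T : Finset (Finset (Fin d → ℝ))) (F : Factor d)
    (c : {σ // σ ∈ indexSet T F} → ℝ) : Finset (Fin d → ℝ) → Field d F.kind :=
  ∑ j, c j • shapePiece o F.kind j.1

theorem isPiecewise_pieceSum (hT : IsRegularTriangulation D T) (ho : o.IsFor T) (hd : d ≠ 0)
    {F : Factor d} (hF : F.IsCompatible T) (c : {σ // σ ∈ indexSet T F} → ℝ) :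
    IsPiecewise T F (pieceSum o T F c) :=
  (piecewiseSpace T F).sum_mem fun j _ =>
    (piecewiseSpace T F).smul_mem _ (isPiecewise_shapePiece hT ho hd hF j.2)

theorem shapeFun_of_mem_interior (hT : IsRegularTriangulation D T) (κ : FEKind)
    (σ : Finset (Fin d → ℝ)) {K : Finset (Fin d → ℝ)} (hK : K ∈ T) {x : Fin d → ℝ}
    (hx : x ∈ interior (convexHull ℝ (K : Set (Fin d → ℝ)))) :
    shapeFun T o κ σ x = shapePiece o κ σ K x := by
  classical
  unfold shapeFun
  have h0 : ∀ K' ∈ T, K' ≠ K →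
      (interior (convexHull ℝ (K' : Set (Fin d → ℝ)))).indicator (localShape o κ K' σ) x = 0 :=
    fun K' hK' hne => Set.indicator_of_notMem
      (fun h => hne (hT.eq_of_mem_interior hK hK' hx (interior_subset h)).symm) _
  by_cases h : σ ⊆ K
  · rw [shapePiece_of_subset h, Finset.sum_eq_single_of_mem K (Finset.mem_filter.2 ⟨hK, h⟩)
      fun K' hK' hne => h0 K' (Finset.mem_filter.1 hK').1 hne, Set.indicator_of_mem hx]
  · rw [shapePiece_of_not_subset h]
    refine Finset.sum_eq_zero fun K' hK' => ?_
    obtain ⟨hK'T, hσ⟩ := Finset.mem_filter.1 hK'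
    exact h0 K' hK'T (by rintro rfl; exact h hσ)

theorem sum_shapeFun_of_mem_interior (hT : IsRegularTriangulation D T) {F : Factor d}
    (c : {σ // σ ∈ indexSet T F} → ℝ) {K : Finset (Fin d → ℝ)} (hK : K ∈ T) {x : Fin d → ℝ}
    (hx : x ∈ interior (convexHull ℝ (K : Set (Fin d → ℝ)))) :
    ∑ j, c j • shapeFun T o F.kind j.1 x = pieceSum o T F c K x := by
  rw [pieceSum, Finset.sum_apply, Finset.sum_apply]
  exact Finset.sum_congr rfl fun j _ => by rw [shapeFun_of_mem_interior hT _ _ hK hx]; rfl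

theorem exists_simplex_of_mem_indexSet {F : Factor d} {σ : Finset (Fin d → ℝ)}
    (hσ : σ ∈ indexSet T F) : ∃ K ∈ T, σ ⊆ K ∧ σ.card = F.kind.numVertices d := by
  classical
  exact mem_subsimplices.1 (Finset.mem_filter.1 hσ).1

open Classical in
theorem dof_pieceSum (hT : IsRegularTriangulation D T) (ho : o.IsFor T) (hd : d ≠ 0)
    {F : Factor d} (c : {σ // σ ∈ indexSet T F} → ℝ) {K σ : Finset (Fin d → ℝ)} (hK : K ∈ T)
    (hσ : σ ⊆ K) (hc : σ.card = F.kind.numVertices d) :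
    dof o F.kind σ (pieceSum o T F c K) = ∑ j, if σ = j.1 then c j else 0 := by
  rw [pieceSum, Finset.sum_apply, map_sum]
  refine Finset.sum_congr rfl fun j _ => ?_
  rw [Pi.smul_apply, map_smul, smul_eq_mul]
  have hj : j.1.card = F.kind.numVertices d :=
    (exists_simplex_of_mem_indexSet j.2).choose_spec.2.2
  by_cases h : j.1 ⊆ K
  · rw [shapePiece_of_subset h, dof_localShape ho hd F.kind hK (hT.isSimplex hK) h hj hσ hc,
      mul_ite, mul_one, mul_zero]
  · rw [shapePiece_of_not_subset h, map_zero, mul_zero, if_neg]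
    rintro rfl
    exact h hσ

theorem dof_pieceSum_index (hT : IsRegularTriangulation D T) (ho : o.IsFor T) (hd : d ≠ 0)
    {F : Factor d} (c : {σ // σ ∈ indexSet T F} → ℝ) {K : Finset (Fin d → ℝ)} (hK : K ∈ T)
    (j : {σ // σ ∈ indexSet T F}) (hj : j.1 ⊆ K) (hc : j.1.card = F.kind.numVertices d) :
    dof o F.kind j.1 (pieceSum o T F c K) = c j := by
  classical
  rw [dof_pieceSum hT ho hd c hK hj hc]
  simp

theorem measurable_shapeFun (κ : FEKind) (σ : Finset (Fin d → ℝ)) :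
    Measurable (shapeFun T o κ σ) := by
  unfold shapeFun
  exact Finset.measurable_sum _ fun K _ =>
    (isLocal_localShape κ K σ).continuous.measurable.indicator isOpen_interior.measurableSet

theorem measurable_sum_shapeFun {F : Factor d} (c : {σ // σ ∈ indexSet T F} → ℝ) :
    Measurable fun x => ∑ j, c j • shapeFun T o F.kind j.1 x :=
  Finset.measurable_sum _ fun j _ =>
    (measurable_shapeFun F.kind j.1).const_smul (c j)

/-- The linear combinations of shape functions, as elements of the finite element space. -/
def combination (hD : IsOpen D) (hT : IsRegularTriangulation D T) (ho : o.IsFor T) (hd : d ≠ 0)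
    {F : Factor d} (hF : F.IsCompatible T) :
    ({σ // σ ∈ indexSet T F} → ℝ) →ₗ[ℝ] feSpace D T F where
  toFun c := ⟨AEEqFun.mk (fun x => ∑ j, c j • shapeFun T o F.kind j.1 x)
      (measurable_sum_shapeFun c).aestronglyMeasurable,
    pieceSum o T F c, isPiecewise_pieceSum hT ho hd hF c, fun K hK => by
      filter_upwards [AEEqFun.coeFn_mk (μ := volume.restrict D) _
        (measurable_sum_shapeFun (o := o) c).aestronglyMeasurable,
        hT.ae_mem_interior hD] with x hx hx2 hxK
      obtain ⟨K', hK', hxK'⟩ := hx2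
      obtain rfl := hT.eq_of_mem_interior hK' hK hxK' hxK
      rw [hx, sum_shapeFun_of_mem_interior hT c hK hxK']⟩
  map_add' c c' := by
    refine Subtype.ext ?_
    change AEEqFun.mk _ _ = AEEqFun.mk _ _ + AEEqFun.mk _ _
    rw [AEEqFun.mk_add_mk]
    congr 1
    funext x
    simp only [Pi.add_apply, add_smul, Finset.sum_add_distrib]
  map_smul' t c := by
    refine Subtype.ext ?_
    change AEEqFun.mk _ _ = t • AEEqFun.mk _ _
    rw [AEEqFun.smul_mk]
    congr 1
    funext x
    simp only [Pi.smul_apply, smul_eq_mul, mul_smul, Finset.smul_sum]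

theorem coeFn_combination (hD : IsOpen D) (hT : IsRegularTriangulation D T) (ho : o.IsFor T)
    (hd : d ≠ 0) {F : Factor d} (hF : F.IsCompatible T) (c : {σ // σ ∈ indexSet T F} → ℝ) :
    ∀ᵐ x ∂(volume.restrict D), (combination hD hT ho hd hF c).1 x =
      ∑ j, c j • shapeFun T o F.kind j.1 x :=
  AEEqFun.coeFn_mk _ _

/-- A combination that vanishes almost everywhere vanishes, by continuity, on the open part of each
simplex in `D`; there it is a single polynomial, which is therefore zero, and `dof` reads off the
coefficients. -/
theorem combination_injective (hD : IsOpen D) (hT : IsRegularTriangulation D T) (ho : o.IsFor T)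
    (hd : d ≠ 0) {F : Factor d} (hF : F.IsCompatible T) :
    Function.Injective (combination hD hT ho hd hF) := by
  rw [injective_iff_map_eq_zero]
  intro c hc
  have h0 : ∀ᵐ x ∂(volume.restrict D), ∑ j, c j • shapeFun T o F.kind j.1 x = 0 := by
    have h1 := coeFn_combination hD hT ho hd hF c
    rw [hc] at h1
    filter_upwards [h1, AEEqFun.coeFn_zero (α := Fin d → ℝ) (μ := volume.restrict D)
      (β := Fin F.valDim → ℝ)] with x hx hx2
    rw [← hx]
    exact hx2
  funext j
  obtain ⟨K, hK, hjK, hjc⟩ := exists_simplex_of_mem_indexSet j.2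
  rw [← dof_pieceSum_index hT ho hd c hK j hjK hjc]
  have hloc := (isPiecewise_pieceSum hT ho hd hF c).isLocal K hK
  set U := interior (convexHull ℝ (K : Set (Fin d → ℝ))) ∩ D with hU
  have hUo : IsOpen U := isOpen_interior.inter hD
  -- The simplex is only known to lie in `closure D`, but its open interior then meets `D`.
  have hUne : U.Nonempty := by
    obtain ⟨x, hx⟩ := (hT.isSimplex hK).interior_convexHull_nonempty
    exact mem_closure_iff.1 (hT.convexHull_subset_closure hK (interior_subset hx)) _
      isOpen_interior hx
  have hae : pieceSum o T F c K =ᵐ[volume.restrict U] 0 := by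
    have h1 := ae_restrict_of_ae_restrict_of_subset (Set.inter_subset_right : U ⊆ D) h0
    filter_upwards [h1, ae_restrict_mem hUo.measurableSet] with x hx hxU
    rw [← sum_shapeFun_of_mem_interior hT c hK hxU.1, hx]
    rfl
  have heq := Measure.eqOn_open_of_ae_eq hae hUo hloc.continuous.continuousOn
    continuous_const.continuousOn
  rw [hloc.eq_zero_of_isOpen hUo hUne heq, map_zero]
  rfl

/-- The coefficients are the degrees of freedom of the pieces, each computed in an arbitrary simplex
`S j`. On every simplex the difference has zero degrees of freedom: for indexed subsimplices by
single-valued traces, for the others by the boundary condition. -/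
theorem combination_surjective (hD : IsOpen D) (hT : IsRegularTriangulation D T) (ho : o.IsFor T)
    (hd : d ≠ 0) {F : Factor d} (hF : F.IsCompatible T) :
    Function.Surjective (combination hD hT ho hd hF) := by
  classical
  rintro ⟨v, p, hp, hv⟩
  choose S hST hS hSc using fun j : {σ // σ ∈ indexSet T F} => exists_simplex_of_mem_indexSet j.2
  set c : {σ // σ ∈ indexSet T F} → ℝ := fun j => dof o F.kind j.1 (p (S j)) with hcdef
  have key : ∀ K ∈ T, p K = pieceSum o T F c K := by
    intro K hK
    have hl : IsLocal F.kind (p K - pieceSum o T F c K) :=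
      (localSpace d F.kind).sub_mem (hp.isLocal K hK)
        ((isPiecewise_pieceSum hT ho hd hF c).isLocal K hK)
    refine sub_eq_zero.1 (hl.eq_zero_of_dof ho hd hK (hT.isSimplex hK) fun σ hσ hσc => ?_)
    rw [map_sub, sub_eq_zero]
    by_cases hi : σ ∈ indexSet T F
    · rw [dof_pieceSum_index hT ho hd c hK ⟨σ, hi⟩ hσ hσc]
      exact (hp.traceEq K hK _ (hST ⟨σ, hi⟩)).dof_eq ho hK hσ (hS ⟨σ, hi⟩) hσc
    · rw [dof_pieceSum hT ho hd c hK hσ hσc, Finset.sum_eq_zero fun j _ =>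
        if_neg fun h : σ = j.1 => hi (h ▸ j.2)]
      have hΓ : convexHull ℝ (σ : Set (Fin d → ℝ)) ⊆ F.bdry := by
        by_contra hcon
        exact hi (Finset.mem_filter.2 ⟨mem_subsimplices.2 ⟨K, hK, hσ, hσc⟩, hcon⟩)
      exact (hp.zeroTrace K hK).dof_eq_zero ho hK hσ hσc hΓ
  refine ⟨c, Subtype.ext (AEEqFun.ext ?_)⟩
  have hv' := (Filter.eventually_all_finset T).2 hv
  filter_upwards [coeFn_combination hD hT ho hd hF c, hT.ae_mem_interior hD, hv']
    with x hx hx2 hx3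
  obtain ⟨K, hK, hxK⟩ := hx2
  rw [hx, hx3 K hK (interior_subset hxK), sum_shapeFun_of_mem_interior hT c hK hxK, key K hK]

variable {m : ℕ} {F : Fin m → Factor d}

/-- The coefficients with respect to the shape functions of the product space. -/
def productEquiv (hD : IsOpen D) (hT : IsRegularTriangulation D T) (ho : o.IsFor T) (hd : d ≠ 0)
    (hF : ∀ k, (F k).IsCompatible T) : (Index T F → ℝ) ≃ₗ[ℝ] ProductSpace D T F :=
  (LinearEquiv.piCurry ℝ fun (k : Fin m) (_ : {σ // σ ∈ indexSet T (F k)}) => ℝ) ≪≫ₗ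
    LinearEquiv.piCongrRight fun k => LinearEquiv.ofBijective (combination hD hT ho hd (hF k))
      ⟨combination_injective hD hT ho hd (hF k), combination_surjective hD hT ho hd (hF k)⟩

theorem coeFn_productEquiv (hD : IsOpen D) (hT : IsRegularTriangulation D T) (ho : o.IsFor T)
    (hd : d ≠ 0) (hF : ∀ k, (F k).IsCompatible T) (c : Index T F → ℝ) (k : Fin m) :
    ∀ᵐ x ∂(volume.restrict D), (productEquiv hD hT ho hd hF c k).1 x =
      ∑ j, c ⟨k, j⟩ • shapeFun T o (F k).kind j.1 x :=
  coeFn_combination hD hT ho hd (hF k) fun j => c ⟨k, j⟩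

theorem existsUnique_coefficients (hD : IsOpen D) (hT : IsRegularTriangulation D T)
    (ho : o.IsFor T) (hd : d ≠ 0) (hF : ∀ k, (F k).IsCompatible T) (v : ProductSpace D T F) :
    ∃! c : Index T F → ℝ, ∀ k, ∀ᵐ x ∂(volume.restrict D),
      (v k).1 x = ∑ j, c ⟨k, j⟩ • shapeFun T o (F k).kind j.1 x := by
  refine ⟨(productEquiv hD hT ho hd hF).symm v, fun k => ?_, fun c hc => ?_⟩
  · have := coeFn_productEquiv hD hT ho hd hF ((productEquiv hD hT ho hd hF).symm v) k
    rwa [LinearEquiv.apply_symm_apply] at this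
  · rw [LinearEquiv.eq_symm_apply]
    funext k
    refine Subtype.ext (AEEqFun.ext ?_)
    filter_upwards [coeFn_productEquiv hD hT ho hd hF c k, hc k] with x hx hx2
    rw [hx, hx2]

theorem finrank_productSpace (hD : IsOpen D) (hT : IsRegularTriangulation D T)
    (ho : o.IsFor T) (hd : d ≠ 0) (hF : ∀ k, (F k).IsCompatible T) :
    Module.finrank ℝ (ProductSpace D T F) = Fintype.card (Index T F) := by
  rw [← (productEquiv hD hT ho hd hF).finrank_eq, Module.finrank_fintype_fun_eq_card]

end Basis

/-! ### Networks that consist of equal blocks -/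

section Nnz

variable {α β γ δ : Type} [Fintype β] [Fintype γ] [Fintype δ]

theorem matNnz_le [Fintype α] (A : Matrix α β ℝ) : matNnz A ≤ Fintype.card α * Fintype.card β := by
  rw [← Fintype.card_prod]
  exact Finset.card_le_univ _

theorem vecNnz_le [Fintype α] (b : α → ℝ) : vecNnz b ≤ Fintype.card α :=
  Finset.card_le_univ _

theorem vecNnz_zero [Fintype α] : vecNnz (0 : α → ℝ) = 0 := by
  simp [vecNnz]

theorem matNnz_submatrix_le [Fintype α] (A : Matrix α β ℝ) (e : γ ≃ α) (f : δ ≃ β) :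
    matNnz (A.submatrix e f) ≤ matNnz A := by
  refine Finset.card_le_card_of_injOn (fun p => (e p.1, f p.2)) (fun p hp => ?_) ?_
  · simpa [Finset.mem_filter] using (Finset.mem_filter.1 hp).2
  · rintro ⟨a, b⟩ _ ⟨a', b'⟩ _ h
    simpa using h

/-- If every column of a matrix is concentrated in one group of rows, then the number of nonzero
entries is at most the number of columns times the maximal size of a group. -/
theorem matNnz_sigma_le {ι : Type} [Fintype ι] {r : ι → ℕ} {s : ℕ} (hr : ∀ i, r i ≤ s)
    (A : Matrix (Σ i, Fin (r i)) γ ℝ) (φ : γ → ι)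
    (h : ∀ i c g, A ⟨i, c⟩ g ≠ 0 → i = φ g) : matNnz A ≤ Fintype.card γ * s := by
  have : Fintype.card (γ × Fin s) = Fintype.card γ * s := by simp
  rw [← this]
  refine Finset.card_le_card_of_injOn (t := Finset.univ)
    (fun p => (p.2, Fin.castLE (hr p.1.1) p.1.2)) (fun p _ => Finset.mem_coe.2 (Finset.mem_univ _))
    ?_
  rintro ⟨⟨i, c⟩, g⟩ hp ⟨⟨i', c'⟩, g'⟩ hp' heq
  simp only [Prod.mk.injEq] at heq
  obtain ⟨rfl, hc⟩ := heq
  have h1 : i = φ g := h i c g (by simpa using hp)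
  have h2 : i' = φ g := h i' c' g (by simpa using hp')
  obtain rfl : i = i' := h1.trans h2.symm
  simpa using hc

/-- The block diagonal matrix with `N` copies of the block `B`. -/
def repeatDiag (N : ℕ) (B : Matrix α β ℝ) : Matrix (Fin N × α) (Fin N × β) ℝ :=
  fun i j => if i.1 = j.1 then B i.2 j.2 else 0

theorem repeatDiag_mulVec (N : ℕ) (B : Matrix α β ℝ) (g : Fin N × β → ℝ) (n : Fin N) (a : α) :
    (repeatDiag N B *ᵥ g) (n, a) = (B *ᵥ fun b => g (n, b)) a := by
  simp only [Matrix.mulVec, dotProduct, repeatDiag, Fintype.sum_prod_type, ite_mul, zero_mul]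
  rw [Finset.sum_eq_single n]
  · simp
  · intro n' _ hn
    simp [hn.symm]
  · simp

theorem matNnz_repeatDiag_le [Fintype α] (N : ℕ) (B : Matrix α β ℝ) :
    matNnz (repeatDiag N B) ≤ N * (Fintype.card α * Fintype.card β) := by
  have : Fintype.card (Fin N × α × β) = N * (Fintype.card α * Fintype.card β) := by simp
  rw [← this]
  refine Finset.card_le_card_of_injOn (t := Finset.univ) (fun p => (p.1.1, p.1.2, p.2.2))
    (fun p _ => Finset.mem_coe.2 (Finset.mem_univ _)) ?_
  rintro ⟨⟨n, a⟩, n', b⟩ hp ⟨⟨k, a'⟩, k', b'⟩ hp' heq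
  have h1 : n = n' := by
    by_contra hne
    simp [repeatDiag, hne] at hp
  have h2 : k = k' := by
    by_contra hne
    simp [repeatDiag, hne] at hp'
  subst h1 h2
  simp only [Prod.mk.injEq] at heq ⊢
  tauto

end Nnz

/-! ### Hidden layers that multiply affine fields by indicators of simplices. -/

section Blocks

/-- The layer whose nodes are indexed by `β`. -/
def HiddenLayers.consOn {n m : ℕ} {β : Type} [Fintype β] (A : Matrix β (Fin n) ℝ) (b : β → ℝ)
    (ϱ : β → Activation) (H : HiddenLayers (Fintype.card β) m) : HiddenLayers n m :=
  .cons (A.submatrix (Fintype.equivFin β).symm (Equiv.refl _)) (b ∘ (Fintype.equivFin β).symm)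
    (ϱ ∘ (Fintype.equivFin β).symm) H

theorem HiddenLayers.eval_consOn {n m : ℕ} {β : Type} [Fintype β] (A : Matrix β (Fin n) ℝ)
    (b : β → ℝ) (ϱ : β → Activation) (H : HiddenLayers (Fintype.card β) m) (x : Fin n → ℝ) :
    (HiddenLayers.consOn A b ϱ H).eval x =
      H.eval ((fun i => (ϱ i).toFun ((A *ᵥ x + b) i)) ∘ (Fintype.equivFin β).symm) := rfl

theorem HiddenLayers.size_consOn_le {n m : ℕ} {β : Type} [Fintype β] (A : Matrix β (Fin n) ℝ)
    (b : β → ℝ) (ϱ : β → Activation) (H : HiddenLayers (Fintype.card β) m) :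
    (HiddenLayers.consOn A b ϱ H).size ≤ matNnz A + Fintype.card β + H.size := by
  have h1 := matNnz_submatrix_le A (Fintype.equivFin β).symm (Equiv.refl (Fin n))
  have h2 := vecNnz_le (b ∘ (Fintype.equivFin β).symm)
  rw [Fintype.card_fin] at h2
  change matNnz _ + vecNnz _ + _ ≤ _
  omega

/-- A matrix whose columns are indexed by the nodes of a layer. -/
def onNodes {α β : Type} [Fintype β] (A : Matrix α β ℝ) : Matrix α (Fin (Fintype.card β)) ℝ :=
  A.submatrix (Equiv.refl _) (Fintype.equivFin β).symm

theorem onNodes_mulVec {α β : Type} [Fintype β] (A : Matrix α β ℝ) (g : β → ℝ) :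
    onNodes A *ᵥ (g ∘ (Fintype.equivFin β).symm) = A *ᵥ g := by
  rw [onNodes, Matrix.submatrix_mulVec_equiv]
  simp [Function.comp_assoc]

theorem matNnz_onNodes_le {α β : Type} [Fintype α] [Fintype β] (A : Matrix α β ℝ) :
    matNnz (onNodes A) ≤ matNnz A :=
  matNnz_submatrix_le A _ _

/-- The sign that belongs to a Boolean. -/
def boolSign : Bool → ℝ
  | true => 1
  | false => -1

/-- A list of `d + 1` half spaces and an affine map of `ℝ^d`. -/
structure Block (d : ℕ) where
  /-- gradients of the functions that define the half spaces -/
  G : Matrix (Fin (d + 1)) (Fin d) ℝ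
  /-- constant terms of the functions that define the half spaces -/
  g : Fin (d + 1) → ℝ
  /-- linear part of the affine map -/
  W : Matrix (Fin d) (Fin d) ℝ
  /-- constant term of the affine map -/
  w : Fin d → ℝ

variable {d : ℕ}

/-- The interior of the intersection of the half spaces. -/
def Block.cell (B : Block d) : Set (Fin d → ℝ) := {x | ∀ j, 0 < (B.G *ᵥ x + B.g) j}

/-- The affine map. -/
def Block.field (B : Block d) (x : Fin d → ℝ) : Fin d → ℝ := B.W *ᵥ x + B.w

variable {N : ℕ}

/-- The activation functions of the first layer: one BiSU for each half space; two ReLUs for each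
component of the affine map. -/
def cellActivation (N d : ℕ) : Fin N × (Fin (d + 1) ⊕ Fin d × Bool) → Activation :=
  fun i => Sum.elim (fun _ => .bisu) (fun _ => .relu) i.2

/-- The activation functions of the second layer: one BiSU for the indicator function of the cell;
two ReLUs for each component of the affine map. -/
def indicatorActivation (N d : ℕ) : Fin N × (Unit ⊕ Fin d × Bool) → Activation :=
  fun i => Sum.elim (fun _ => .bisu) (fun _ => .relu) i.2

/-- The activation functions of the third and the fourth layer. -/
def outputActivation (N d : ℕ) : Fin N × (Fin d × Bool) → Activation := fun _ => .relu

/-- The weights of the first layer. -/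
def cellMatrix (B : Fin N → Block d) :
    Matrix (Fin N × (Fin (d + 1) ⊕ Fin d × Bool)) (Fin d) ℝ :=
  fun i => Sum.elim (fun j => (B i.1).G j) (fun q => boolSign q.2 • (B i.1).W q.1) i.2

/-- The biases of the first layer. -/
def cellBias (B : Fin N → Block d) : Fin N × (Fin (d + 1) ⊕ Fin d × Bool) → ℝ :=
  fun i => Sum.elim (fun j => (B i.1).g j) (fun q => boolSign q.2 * (B i.1).w q.1) i.2

/-- The weights of one block of the second layer. -/
def indicatorMatrix (d : ℕ) : Matrix (Unit ⊕ Fin d × Bool) (Fin (d + 1) ⊕ Fin d × Bool) ℝ :=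
  Matrix.fromBlocks (Matrix.of fun _ _ => 1) 0 0 1

/-- The biases of the second layer. -/
def indicatorBias (N d : ℕ) : Fin N × (Unit ⊕ Fin d × Bool) → ℝ :=
  -- The threshold lies strictly between `d` and `d + 1`: the node fires only if all `d + 1`
  -- half-space indicators are `1`.
  fun i => Sum.elim (fun _ => -((d : ℝ) + 1 / 2)) (fun _ => 0) i.2

/-- The weights of one block of the third layer. -/
def productMatrix (d : ℕ) (M : ℝ) : Matrix (Fin d × Bool) (Unit ⊕ Fin d × Bool) ℝ :=
  Matrix.fromCols (Matrix.of fun _ _ => M)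
    (Matrix.of fun q q' => if q.1 = q'.1 then boolSign q.2 * boolSign q'.2 else 0)

theorem indicatorMatrix_mulVec_inl (g : Fin (d + 1) ⊕ Fin d × Bool → ℝ) (j : Unit) :
    (indicatorMatrix d *ᵥ g) (.inl j) = ∑ i, g (.inl i) := by
  simp [indicatorMatrix, Matrix.mulVec, dotProduct]

theorem indicatorMatrix_mulVec_inr (g : Fin (d + 1) ⊕ Fin d × Bool → ℝ) (q : Fin d × Bool) :
    (indicatorMatrix d *ᵥ g) (.inr q) = g (.inr q) := by
  simp [indicatorMatrix, Matrix.mulVec, dotProduct, Matrix.one_apply]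

theorem productMatrix_mulVec (M : ℝ) (g : Unit ⊕ Fin d × Bool → ℝ) (c : Fin d) (s : Bool) :
    (productMatrix d M *ᵥ g) (c, s) =
      M * g (.inl ()) + (boolSign s * g (.inr (c, true)) - boolSign s * g (.inr (c, false))) := by
  simp only [productMatrix, Matrix.mulVec, dotProduct, Fintype.sum_sum_type,
    Matrix.fromCols_apply_inl,
    Matrix.fromCols_apply_inr, Matrix.of_apply, Fintype.sum_prod_type, Fintype.sum_bool, ite_mul,
    zero_mul, Finset.sum_add_distrib, Finset.sum_ite_eq, Finset.mem_univ, if_true,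
    Finset.univ_unique, Finset.sum_singleton]
  simp only [boolSign, PUnit.default_eq_unit]
  ring

/-- The hidden layers that emulate the products of the affine maps and the indicator functions of
the cells; `M` is a bound for the values of the affine maps. -/
def blockLayers (B : Fin N → Block d) (M : ℝ) :
    HiddenLayers d (Fintype.card (Fin N × (Fin d × Bool))) :=
  .consOn (cellMatrix B) (cellBias B) (cellActivation N d) <|
  .consOn (onNodes (repeatDiag N (indicatorMatrix d))) (indicatorBias N d)
    (indicatorActivation N d) <|
  .consOn (onNodes (repeatDiag N (productMatrix d M))) (fun _ => -M) (outputActivation N d) <|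
  -- The incoming values are nonnegative, so this layer is the identity; it serves to reach depth
  -- five.
  .consOn (onNodes (repeatDiag N (1 : Matrix (Fin d × Bool) (Fin d × Bool) ℝ))) 0
    (outputActivation N d) <|
  .nil _

/-- The dimensions and the activation functions of the hidden layers. -/
def blockArchitecture (N d : ℕ) : List (List Activation) :=
  [List.ofFn (cellActivation N d ∘ (Fintype.equivFin _).symm),
    List.ofFn (indicatorActivation N d ∘ (Fintype.equivFin _).symm),
    List.ofFn (outputActivation N d ∘ (Fintype.equivFin _).symm),
    List.ofFn (outputActivation N d ∘ (Fintype.equivFin _).symm)]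

theorem architecture_blockLayers (B : Fin N → Block d) (M : ℝ) :
    (blockLayers B M).architecture = blockArchitecture N d := rfl

theorem size_blockLayers_le (B : Fin N → Block d) (M : ℝ) (hd : 1 ≤ d) :
    (blockLayers B M).size ≤ N * (37 * d ^ 2) := by
  refine (HiddenLayers.size_consOn_le _ _ _ _).trans ?_
  refine (Nat.add_le_add (Nat.add_le_add_right (matNnz_le _) _)
    (HiddenLayers.size_consOn_le _ _ _ _)).trans ?_
  refine (Nat.add_le_add_left (Nat.add_le_add (Nat.add_le_add_right
    ((matNnz_onNodes_le _).trans (matNnz_repeatDiag_le _ _)) _)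
    (HiddenLayers.size_consOn_le _ _ _ _)) _).trans ?_
  refine (Nat.add_le_add_left (Nat.add_le_add_left (Nat.add_le_add (Nat.add_le_add_right
    ((matNnz_onNodes_le _).trans (matNnz_repeatDiag_le _ _)) _)
    (HiddenLayers.size_consOn_le _ _ _ _)) _) _).trans ?_
  refine (Nat.add_le_add_left (Nat.add_le_add_left (Nat.add_le_add_left (Nat.add_le_add_right
    (Nat.add_le_add_right ((matNnz_onNodes_le _).trans (matNnz_repeatDiag_le _ _)) _) _) _)
    _) _).trans ?_
  simp only [Fintype.card_prod, Fintype.card_fin, Fintype.card_sum, Fintype.card_bool,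
    Fintype.card_unit, HiddenLayers.size]
  have hd2 : d ≤ d ^ 2 := by nlinarith
  -- The dense count per block is `17 d ^ 2 + 17 d + 3`, and `17 + 17 + 3 = 37`.
  have h : (d + 1 + d * 2) * d + (d + 1 + d * 2) + ((1 + d * 2) * (d + 1 + d * 2) + (1 + d * 2) +
      (d * 2 * (1 + d * 2) + d * 2 + (d * 2 * (d * 2) + d * 2))) ≤ 37 * d ^ 2 := by nlinarith
  refine le_trans (le_of_eq ?_) (Nat.mul_le_mul_left N h)
  ring

theorem boolSign_mul_cancel (s : Bool) (y : ℝ) :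
    boolSign s * max 0 (boolSign true * y) - boolSign s * max 0 (boolSign false * y) =
      boolSign s * y := by
  rw [← mul_sub]
  congr 1
  simp only [boolSign]
  rcases le_total 0 y with h | h
  · rw [max_eq_right (by linarith), max_eq_left (by linarith)]; ring
  · rw [max_eq_left (by linarith), max_eq_right (by linarith)]; ring

-- The positive and negative parts of the field pass through the second layer unchanged and are
-- recombined to `± y` in the third, where `M χ - M` is added. Inside the cell this term is zero;
-- outside it is `-M`, which pushes the argument of ReLU below zero because `|y| ≤ M`.
open Classical in
theorem eval_blockLayers (B : Fin N → Block d) {M : ℝ} {x : Fin d → ℝ}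
    (hM : ∀ n c, |(B n).field x c| ≤ M) :
    (blockLayers B M).eval x = (fun i : Fin N × (Fin d × Bool) =>
      if x ∈ (B i.1).cell then max 0 (boolSign i.2.2 * (B i.1).field x i.2.1) else 0) ∘
        (Fintype.equivFin _).symm := by
  have h1 : (fun i => (cellActivation N d i).toFun ((cellMatrix B *ᵥ x + cellBias B) i)) =
      fun i : Fin N × (Fin (d + 1) ⊕ Fin d × Bool) =>
        Sum.elim (fun j => if 0 < ((B i.1).G *ᵥ x + (B i.1).g) j then (1 : ℝ) else 0)
          (fun q => max 0 (boolSign q.2 * (B i.1).field x q.1)) i.2 := by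
    funext ⟨n, i⟩
    rcases i with j | q
    · rfl
    · change max 0 ((boolSign q.2 • (B n).W q.1) ⬝ᵥ x + boolSign q.2 * (B n).w q.1) =
        max 0 (boolSign q.2 * ((B n).W q.1 ⬝ᵥ x + (B n).w q.1))
      rw [smul_dotProduct, smul_eq_mul, mul_add]
  have h2 : (fun i => (indicatorActivation N d i).toFun ((repeatDiag N (indicatorMatrix d) *ᵥ
      (fun i : Fin N × (Fin (d + 1) ⊕ Fin d × Bool) =>
        Sum.elim (fun j => if 0 < ((B i.1).G *ᵥ x + (B i.1).g) j then (1 : ℝ) else 0)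
          (fun q => max 0 (boolSign q.2 * (B i.1).field x q.1)) i.2) + indicatorBias N d) i)) =
      fun i : Fin N × (Unit ⊕ Fin d × Bool) =>
        Sum.elim (fun _ => if x ∈ (B i.1).cell then (1 : ℝ) else 0)
          (fun q => max 0 (boolSign q.2 * (B i.1).field x q.1)) i.2 := by
    funext ⟨n, i⟩
    rw [Pi.add_apply, repeatDiag_mulVec]
    rcases i with j | q
    · rw [indicatorMatrix_mulVec_inl]
      simp only [Sum.elim_inl, indicatorActivation, indicatorBias, Activation.toFun,
        Finset.sum_boole]
      refine if_congr ?_ rfl rfl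
      constructor
      · intro h
        by_contra hx
        have hlt : (Finset.univ.filter fun j =>
            0 < ((B n).G *ᵥ x + (B n).g) j).card < d + 1 := by
          have : (Finset.univ.filter fun j => 0 < ((B n).G *ᵥ x + (B n).g) j) ⊂ Finset.univ := by
            rw [Finset.filter_ssubset]
            simp only [Block.cell, Set.mem_ofPred_eq, not_forall] at hx
            obtain ⟨j, hj⟩ := hx
            exact ⟨j, Finset.mem_univ j, hj⟩
          simpa using Finset.card_lt_card this
        have hle : ((Finset.univ.filter fun j =>
            0 < ((B n).G *ᵥ x + (B n).g) j).card : ℝ) ≤ d := by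
          exact_mod_cast Nat.lt_succ_iff.1 hlt
        linarith
      · intro hx
        have : (Finset.univ.filter fun j => 0 < ((B n).G *ᵥ x + (B n).g) j) = Finset.univ :=
          Finset.filter_true_of_mem fun j _ => hx j
        rw [this, Finset.card_univ, Fintype.card_fin]
        push_cast
        linarith
    · rw [indicatorMatrix_mulVec_inr]
      simp [indicatorActivation, indicatorBias, Activation.toFun]
  have h3 : (fun i => (outputActivation N d i).toFun ((repeatDiag N (productMatrix d M) *ᵥ
      (fun i : Fin N × (Unit ⊕ Fin d × Bool) =>
        Sum.elim (fun _ => if x ∈ (B i.1).cell then (1 : ℝ) else 0)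
          (fun q : Fin d × Bool => max 0 (boolSign q.2 * (B i.1).field x q.1)) i.2) +
        (fun _ => -M : Fin N × (Fin d × Bool) → ℝ)) i)) =
      fun i : Fin N × (Fin d × Bool) =>
        if x ∈ (B i.1).cell then max 0 (boolSign i.2.2 * (B i.1).field x i.2.1) else 0 := by
    funext ⟨n, c, s⟩
    rw [Pi.add_apply, repeatDiag_mulVec, productMatrix_mulVec]
    simp only [outputActivation, Activation.toFun, Sum.elim_inl, Sum.elim_inr]
    rw [boolSign_mul_cancel]
    have hb := hM n c
    rw [abs_le] at hb
    split_ifs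
    · congr 1; ring
    · refine max_eq_left ?_
      cases s <;> simp only [boolSign] <;> linarith
  have h4 : (fun i => (outputActivation N d i).toFun
      ((repeatDiag N (1 : Matrix (Fin d × Bool) (Fin d × Bool) ℝ) *ᵥ
      (fun i : Fin N × (Fin d × Bool) =>
        if x ∈ (B i.1).cell then max 0 (boolSign i.2.2 * (B i.1).field x i.2.1) else 0) +
        0) i)) =
      fun i : Fin N × (Fin d × Bool) =>
        if x ∈ (B i.1).cell then max 0 (boolSign i.2.2 * (B i.1).field x i.2.1) else 0 := by
    funext ⟨n, q⟩
    rw [add_zero, repeatDiag_mulVec, Matrix.one_mulVec]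
    refine max_eq_right ?_
    dsimp only
    split_ifs
    · exact le_max_left _ _
    · exact le_rfl
  rw [blockLayers, HiddenLayers.eval_consOn, HiddenLayers.eval_consOn, HiddenLayers.eval_consOn,
    HiddenLayers.eval_consOn, onNodes_mulVec,
    onNodes_mulVec, onNodes_mulVec, h1, h2, h3, h4]
  rfl

/-- The weights of the output layer. -/
def outputMatrix {ι : Type} (a : ι → Fin N → Fin d → ℝ) : Matrix ι (Fin N × Fin d × Bool) ℝ :=
  Matrix.of fun i p => a i p.1 p.2.1 * boolSign p.2.2

/-- The network whose outputs are linear combinations of the components of the affine maps times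
the indicator functions of the cells. -/
def blockNet {ι : Type} (B : Fin N → Block d) (M : ℝ) (a : ι → Fin N → Fin d → ℝ) :
    NeuralNet d ι where
  width := _
  hidden := blockLayers B M
  A := onNodes (outputMatrix a)
  b := 0

theorem realize_blockNet {ι : Type} (B : Fin N → Block d) {M : ℝ} (a : ι → Fin N → Fin d → ℝ)
    {x : Fin d → ℝ} (hM : ∀ n c, |(B n).field x c| ≤ M) (i : ι) :
    (blockNet B M a).realize x i =
      ∑ n, ∑ c, a i n c * (B n).cell.indicator (fun x => (B n).field x c) x := by
  classical
  change (onNodes (outputMatrix a) *ᵥ (blockLayers B M).eval x + 0) i = _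
  rw [eval_blockLayers B hM, onNodes_mulVec, add_zero, Matrix.mulVec, dotProduct]
  simp only [Fintype.sum_prod_type, Fintype.sum_bool, outputMatrix, Matrix.of_apply]
  refine Finset.sum_congr rfl fun n _ => Finset.sum_congr rfl fun c _ => ?_
  by_cases hx : x ∈ (B n).cell
  · rw [Set.indicator_of_mem hx]
    simp only [hx, if_true]
    have := boolSign_mul_cancel true ((B n).field x c)
    simp only [boolSign, one_mul] at this ⊢
    linear_combination a i n c * this
  · rw [Set.indicator_of_notMem hx]
    simp [hx]

/-- A block feeds only the outputs of one index `φ n`, at most `d` of them, from `2 d` nodes. The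
output layer adds `2 d ^ 2` per block to the `37 d ^ 2` of the hidden layers. -/
theorem size_blockNet_le {ι : Type} [Fintype ι] {r : ι → ℕ} (hr : ∀ i, r i ≤ d) (hd : 1 ≤ d)
    (B : Fin N → Block d) (M : ℝ) (a : (Σ i, Fin (r i)) → Fin N → Fin d → ℝ) (φ : Fin N → ι)
    (h : ∀ i c n c', a ⟨i, c⟩ n c' ≠ 0 → i = φ n) :
    (blockNet B M a).size ≤ N * (39 * d ^ 2) := by
  have h1 := size_blockLayers_le B M hd
  have h2 := (matNnz_onNodes_le (outputMatrix a)).trans (matNnz_sigma_le hr (outputMatrix a)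
    (fun p => φ p.1) fun i c p hp => h i c p.1 p.2.1 (left_ne_zero_of_mul hp))
  have h3 : vecNnz (0 : (Σ i, Fin (r i)) → ℝ) = 0 := vecNnz_zero
  simp only [Fintype.card_prod, Fintype.card_fin, Fintype.card_bool] at h2
  change (blockLayers B M).size + matNnz (onNodes (outputMatrix a)) +
    vecNnz (0 : (Σ i, Fin (r i)) → ℝ) ≤ _
  rw [h3]
  nlinarith

end Blocks

/-! ### Emulation of the shape functions -/

section Emulation

variable {d m : ℕ} {D : Set (Fin d → ℝ)} {T : Finset (Finset (Fin d → ℝ))} {o : Orientation d}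
  {F : Fin m → Factor d}

theorem FEKind.valDim_le (κ : FEKind) (hd : 1 ≤ d) : κ.valDim d ≤ d := by
  cases κ
  · exact hd
  · exact le_rfl
  · exact le_rfl

/-- Scalar shape functions are padded with zero components to `d`, so that blocks have the same
shape for all kinds of elements and the architecture depends only on their number and on `d`. -/
theorem exists_block (κ : FEKind) {K : Finset (Fin d → ℝ)} (hK : IsSimplex K)
    (σ : Finset (Fin d → ℝ)) :
    ∃ B : Block d, B.cell = interior (convexHull ℝ (K : Set (Fin d → ℝ))) ∧
      ∀ x (c : Fin d), B.field x c =
        if h : c.1 < κ.valDim d then localShape o κ K σ x ⟨c.1, h⟩ else 0 := by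
  obtain ⟨W, w, hW⟩ := (isLocal_localShape (o := o) κ K σ).exists_matrix
  have e : Fin (d + 1) ≃ K := (Fintype.equivFinOfCardEq (by simpa using hK.card_eq)).symm
  refine ⟨⟨Matrix.of fun j => grad (bary K (e j)), fun j => bary K (e j) 0,
    Matrix.of fun c => if h : c.1 < κ.valDim d then W ⟨c.1, h⟩ else 0,
    fun c => if h : c.1 < κ.valDim d then w ⟨c.1, h⟩ else 0⟩, ?_, fun x c => ?_⟩
  · ext x
    rw [hK.mem_interior_convexHull_iff]
    have h : ∀ j, (Matrix.of (fun j => grad (bary K (e j))) *ᵥ x +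
        fun j => bary K (e j) 0) j = bary K (e j) x := fun j =>
      (apply_eq_grad_dotProduct_add (bary K (e j)) x).symm
    refine (forall_congr' fun j => by rw [← h j] : x ∈ Block.cell _ ↔
      ∀ j, 0 < bary K (e j) x).trans ⟨fun h a ha => ?_, fun h j => h _ (e j).2⟩
    have := h (e.symm ⟨a, ha⟩)
    rwa [e.apply_symm_apply] at this
  · change (if h : c.1 < κ.valDim d then W ⟨c.1, h⟩ else 0) ⬝ᵥ x +
      (if h : c.1 < κ.valDim d then w ⟨c.1, h⟩ else 0) = _
    split_ifs with h
    · rw [hW]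
      rfl
    · simp

open Classical in
/-- The simplices of `T` that share `σ`. -/
def star (T : Finset (Finset (Fin d → ℝ))) (σ : Finset (Fin d → ℝ)) :
    Finset (Finset (Fin d → ℝ)) := T.filter fun K => σ ⊆ K

theorem card_star (T : Finset (Finset (Fin d → ℝ))) (σ : Finset (Fin d → ℝ)) :
    (star T σ).card = starCard T σ := by
  unfold star starCard
  congr!

/-- The pairs of a shape function and a simplex in its support. -/
abbrev ShapeCell (T : Finset (Finset (Fin d → ℝ))) (F : Fin m → Factor d) : Type :=
  Σ i : Index T F, {K // K ∈ star T i.2.1}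

theorem card_shapeCell : Fintype.card (ShapeCell T F) = starSum T F := by
  rw [Fintype.card_sigma, starSum]
  exact Finset.sum_congr rfl fun i _ => by rw [Fintype.card_coe, card_star]

/-- The number of blocks can be read off from `starData`, hence so can the architecture. -/
theorem sum_starData : ((starData T F).map Multiset.sum).sum = starSum T F := by
  rw [starData, List.map_ofFn, List.sum_ofFn, starSum, Fintype.sum_sigma]
  refine Finset.sum_congr rfl fun k _ => ?_
  exact (Finset.sum_coe_sort (indexSet T (F k)) (starCard T)).symm

/-- An enumeration of the pairs of a shape function and a simplex in its support. -/
def cellEquiv (T : Finset (Finset (Fin d → ℝ))) (F : Fin m → Factor d) :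
    Fin (starSum T F) ≃ ShapeCell T F :=
  (Fintype.equivFinOfCardEq card_shapeCell).symm

theorem exists_blocks (hT : IsRegularTriangulation D T) (o : Orientation d)
    (F : Fin m → Factor d) :
    ∃ B : ShapeCell T F → Block d, ∀ b,
      (B b).cell = interior (convexHull ℝ (b.2.1 : Set (Fin d → ℝ))) ∧
      ∀ x (c : Fin d), (B b).field x c =
        if h : c.1 < (F b.1.1).valDim then
          localShape o (F b.1.1).kind b.2.1 b.1.2.1 x ⟨c.1, h⟩ else 0 := by
  classical
  choose B hB using fun b : ShapeCell T F => exists_block (o := o) (F b.1.1).kind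
    (hT.isSimplex (Finset.mem_filter.1 b.2.2).1) b.1.2.1
  exact ⟨B, hB⟩

theorem exists_bound_blocks {N : ℕ} (hD : Bornology.IsBounded D) (B : Fin N → Block d) :
    ∃ M, ∀ x ∈ D, ∀ n c, |(B n).field x c| ≤ M := by
  have hcont : Continuous fun x => fun (n : Fin N) (c : Fin d) => (B n).field x c := by
    refine continuous_pi fun n => continuous_pi fun c => ?_
    have : Continuous fun x => (B n).W *ᵥ x + (B n).w := by fun_prop
    exact (continuous_apply c).comp this
  obtain ⟨M, hM⟩ := hD.isCompact_closure.exists_bound_of_continuousOn hcont.continuousOn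
  refine ⟨M, fun x hx n c => ?_⟩
  rw [← Real.norm_eq_abs]
  exact (norm_le_pi_norm (fun c => (B n).field x c) c).trans
    ((norm_le_pi_norm (fun n => fun c => (B n).field x c) n).trans (hM x (subset_closure hx)))

/-- The weights of the cells in a linear combination of the components with number `c` of the
shape functions. -/
def cellWeight (T : Finset (Finset (Fin d → ℝ))) (F : Fin m → Factor d) (β : Index T F → ℝ) (c : ℕ)
    (n : Fin (starSum T F)) (c' : Fin d) : ℝ :=
  if c'.1 = c then β (cellEquiv T F n).1 else 0

/-- Grouping the pairs of an index and a simplex by the index, the inner sums over the star are the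
shape functions. The identity holds at every point, also on faces, since cells and `shapeFun` both
use open simplices. -/
theorem sum_cellWeight {B : ShapeCell T F → Block d}
    (hB : ∀ b, (B b).cell = interior (convexHull ℝ (b.2.1 : Set (Fin d → ℝ))) ∧
      ∀ x (c : Fin d), (B b).field x c =
        if h : c.1 < (F b.1.1).valDim then
          localShape o (F b.1.1).kind b.2.1 b.1.2.1 x ⟨c.1, h⟩ else 0)
    (β : Index T F → ℝ) {c : ℕ} (hc : c < d) (x : Fin d → ℝ) :
    ∑ n, ∑ c', cellWeight T F β c n c' *
        (B (cellEquiv T F n)).cell.indicator (fun x => (B (cellEquiv T F n)).field x c') x =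
      ∑ i : Index T F, β i * if h : c < (F i.1).valDim then
        shapeFun T o (F i.1).kind i.2.1 x ⟨c, h⟩ else 0 := by
  classical
  have h1 : ∀ n, ∑ c', cellWeight T F β c n c' *
        (B (cellEquiv T F n)).cell.indicator (fun x => (B (cellEquiv T F n)).field x c') x =
      β (cellEquiv T F n).1 * (B (cellEquiv T F n)).cell.indicator
        (fun x => (B (cellEquiv T F n)).field x ⟨c, hc⟩) x := by
    intro n
    rw [Finset.sum_eq_single ⟨c, hc⟩]
    · simp [cellWeight]
    · intro c' _ hne
      rw [cellWeight, if_neg fun h => hne (Fin.ext h), zero_mul]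
    · simp
  simp only [h1]
  rw [(cellEquiv T F).sum_comp fun b => β b.1 * (B b).cell.indicator
    (fun x => (B b).field x ⟨c, hc⟩) x, Fintype.sum_sigma]
  refine Finset.sum_congr rfl fun i _ => ?_
  dsimp only
  rw [← Finset.mul_sum]
  congr 1
  simp only [hB]
  split_ifs with h
  · rw [shapeFun, Finset.sum_apply]
    refine (Finset.sum_coe_sort (star T i.2.1) fun K => (interior (convexHull ℝ
      (K : Set (Fin d → ℝ)))).indicator (fun x => localShape o (F i.1).kind K i.2.1 x ⟨c, h⟩)
      x).trans ?_
    refine Finset.sum_congr rfl fun K _ => ?_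
    by_cases hx : x ∈ interior (convexHull ℝ (K : Set (Fin d → ℝ)))
    · rw [Set.indicator_of_mem hx, Set.indicator_of_mem hx]
    · rw [Set.indicator_of_notMem hx, Set.indicator_of_notMem hx]
      rfl
  · simp

theorem starSum_le (T : Finset (Finset (Fin d → ℝ))) (F : Fin m → Factor d) :
    starSum T F ≤ starMax T F * Fintype.card (Index T F) := by
  rw [mul_comm, ← smul_eq_mul, ← Finset.card_univ]
  exact Finset.sum_le_card_nsmul _ _ _ fun i hi =>
    Finset.le_sup (f := fun i : Index T F => starCard T i.2) hi

end Emulation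

/-! ### What the general argument needs from the four families. -/

/-- The bound `d ≤ 2 * δ` is there for the space-time case, where the network sees `n + 1` variables
but the estimate is stated with `n ≥ 1`. -/
theorem IsProductSpace.properties {P : Problem} {δ d m : ℕ} {D : Set (Fin d → ℝ)}
    {F : Fin m → Factor d} (h : IsProductSpace P δ D F) :
    1 ≤ d ∧ d ≤ 2 * δ ∧ IsOpen D ∧
      ∀ T, IsRegularTriangulation D T → ∀ k, (F k).IsCompatible T := by
  have hS1 : ∀ {d : ℕ} {D : Set (Fin d → ℝ)}, IsPolytopalDomain D → ∀ T,
      IsRegularTriangulation D T → (⟨.S1, frontier D⟩ : Factor d).IsCompatible T :=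
    fun hD T hT => ⟨fun _ K hK a ha haD x hx => hT.bary_eq_zero_of_mem_frontier hD.isOpen
      hD.interior_closure hK ha haD hx, nofun⟩
  have hRT : ∀ {d : ℕ} (T : Finset (Finset (Fin d → ℝ))),
      (⟨.RT0, ∅⟩ : Factor d).IsCompatible T := fun T => ⟨nofun, fun _ => rfl⟩
  have hN0 : ∀ {d : ℕ} (T : Finset (Finset (Fin d → ℝ))) (Γ : Set (Fin d → ℝ)),
      (⟨.N0, Γ⟩ : Factor d).IsCompatible T := fun T Γ => ⟨nofun, nofun⟩
  cases h with
  | poisson hd hD =>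
    refine ⟨by omega, by omega, hD.isOpen, fun T hT k => ?_⟩
    refine Fin.cases (hS1 hD T hT) (fun k => ?_) k
    rw [Subsingleton.elim k 0]
    exact hRT T
  | elasticity hd hD =>
    refine ⟨by omega, by omega, hD.isOpen, fun T hT k => ?_⟩
    refine Fin.addCases (fun k => ?_) (fun k => ?_) k
    · rw [Fin.append_left]
      exact hS1 hD T hT
    · rw [Fin.append_right]
      exact hRT T
  | maxwell hd _ hD =>
    refine ⟨by omega, by omega, hD.isOpen, fun T hT k => ?_⟩
    refine Fin.cases (hN0 T _) (fun k => ?_) k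
    rw [Subsingleton.elim k 0]
    exact hN0 T _
  | spaceTime hn hτ hG =>
    refine ⟨by omega, by omega, isOpen_cylinder hG.isOpen, fun T hT k => ?_⟩
    refine Fin.cases ?_ (fun k => ?_) k
    · exact ⟨fun _ K hK a ha haD x hx => hT.bary_eq_zero_of_mem_lateralBoundary hτ hG.isOpen
        hG.interior_closure hK ha haD hx, nofun⟩
    · rw [Fin.cons_succ]
      exact ⟨fun _ K _ a _ _ x hx => absurd hx.2 (Set.notMem_empty x), nofun⟩

/-- An injective map transports the vector space structure to its range. -/
theorem exists_module_range {V X : Type*} [AddCommGroup V] [Module ℝ V] (Ψ : V → X)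
    (hΨ : Function.Injective Ψ) :
    ∃ (_ : AddCommGroup (Set.range Ψ)) (_ : Module ℝ (Set.range Ψ))
      (R : Set.range Ψ ≃ₗ[ℝ] V),
      (∀ (v w : V) (t : ℝ), (⟨Ψ v, v, rfl⟩ + t • ⟨Ψ w, w, rfl⟩ : Set.range Ψ) =
        ⟨Ψ (v + t • w), v + t • w, rfl⟩) ∧ ∀ v, R ⟨Ψ v, v, rfl⟩ = v := by
  let e : Set.range Ψ ≃ V := (Equiv.ofInjective Ψ hΨ).symm
  have he : ∀ v, e ⟨Ψ v, v, rfl⟩ = v := fun v => (Equiv.ofInjective Ψ hΨ).symm_apply_apply v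
  let _ := e.addCommGroup
  let _ := e.module ℝ
  refine ⟨inferInstance, inferInstance, e.linearEquiv ℝ, fun v w t => ?_, he⟩
  apply (e.linearEquiv ℝ).injective
  rw [map_add, map_smul]
  change e _ + t • e _ = e _
  rw [he, he, he]

end Fosls

end

/-! ### Assembly of the proposition. -/

open Fosls in
theorem proposition4p5 :
    ∃ (C : ℝ) (arch : Problem → ℕ → List (Multiset ℕ) → List (List Activation)), 0 < C ∧
    ∀ (P : Problem) (δ d m : ℕ) (D : Set (Fin d → ℝ)) (F : Fin m → Factor d),
      IsProductSpace P δ D F →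
    ∀ (T : Finset (Finset (Fin d → ℝ))), IsRegularTriangulation D T →
    ∀ (o : Orientation d), o.IsFor T →
      -- the shape functions are a basis
      Module.finrank ℝ (ProductSpace D T F) = Fintype.card (Index T F) ∧
      (∀ v : ProductSpace D T F, ∃! c : Index T F → ℝ, ∀ k,
        ∀ᵐ x ∂(volume.restrict D),
          (v k).1 x = ∑ j, c ⟨k, j⟩ • shapeFun T o (F k).kind j.1 x) ∧
      C * (δ : ℝ) ^ 2 * (starSum T F : ℝ) ≤
        C * (δ : ℝ) ^ 2 * ((starMax T F : ℝ) * (Module.finrank ℝ (ProductSpace D T F) : ℝ)) ∧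
      ∃ (Φ : NeuralNet d (Σ i : Index T F, Fin (F i.1).valDim))
        (Ψ : ProductSpace D T F → NeuralNet d (Σ k : Fin m, Fin (F k).valDim)),
        -- emulation of the shape functions
        (∀ᵐ x ∂(volume.restrict D), ∀ (i : Index T F) (c : Fin (F i.1).valDim),
          Φ.realize x ⟨i, c⟩ = shapeFun T o (F i.1).kind i.2.1 x c) ∧
        Φ.depth = 5 ∧
        (Φ.size : ℝ) ≤ C * (δ : ℝ) ^ 2 * (starSum T F : ℝ) ∧
        Φ.hidden.architecture = arch P d (starData T F) ∧
        -- emulation of finite element functions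
        (∀ v : ProductSpace D T F,
          (∀ᵐ x ∂(volume.restrict D), ∀ (k : Fin m) (c : Fin (F k).valDim),
            (Ψ v).realize x ⟨k, c⟩ = (v k).1 x c) ∧
          (Ψ v).depth = 5 ∧
          ((Ψ v).size : ℝ) ≤ C * (δ : ℝ) ^ 2 * (starSum T F : ℝ) ∧
          (Ψ v).hiddenPart = Φ.hiddenPart) ∧
        -- the networks form a vector space, and the realization is a linear isomorphism
        ∃ (_ : AddCommGroup (Set.range Ψ)) (_ : Module ℝ (Set.range Ψ))
          (R : Set.range Ψ ≃ₗ[ℝ] ProductSpace D T F),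
          (∀ (v w : ProductSpace D T F) (t : ℝ),
            (⟨Ψ v, v, rfl⟩ + t • ⟨Ψ w, w, rfl⟩ : Set.range Ψ) =
              ⟨Ψ (v + t • w), v + t • w, rfl⟩) ∧
          ∀ (N : Set.range Ψ) (k : Fin m), ∀ᵐ x ∂(volume.restrict D),
            (R N k).1 x = fun c => N.1.realize x ⟨k, c⟩ := by
  classical
  -- The constant is `39 * 4`: a block costs `39 d ^ 2`, and `d ≤ 2 * δ`. The number of blocks is
  -- the total of all entries of `starData`.
  refine ⟨156, fun _ d s => blockArchitecture (s.map Multiset.sum).sum d, by norm_num, ?_⟩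
  intro P δ d m D F hPF T hT o ho
  obtain ⟨hd, hdδ, hD, hcomp⟩ := hPF.properties
  have hF := hcomp T hT
  have hd0 : d ≠ 0 := by omega
  have hrank := finrank_productSpace hD hT ho hd0 hF
  refine ⟨hrank, existsUnique_coefficients hD hT ho hd0 hF, ?_, ?_⟩
  · rw [hrank]
    have : (starSum T F : ℝ) ≤ (starMax T F : ℝ) * (Fintype.card (Index T F) : ℝ) := by
      exact_mod_cast starSum_le T F
    gcongr
  obtain ⟨B, hB⟩ := exists_blocks hT o F
  obtain ⟨M, hM⟩ := exists_bound_blocks hT.isBounded fun n => B (cellEquiv T F n)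
  have hval : ∀ k, (F k).valDim ≤ d := fun k => (F k).kind.valDim_le hd
  have hsize : ∀ S : ℕ, S ≤ starSum T F * (39 * d ^ 2) →
      (S : ℝ) ≤ 156 * (δ : ℝ) ^ 2 * (starSum T F : ℝ) := by
    intro S hS
    have h1 : S ≤ 156 * δ ^ 2 * starSum T F :=
      calc S ≤ starSum T F * (39 * d ^ 2) := hS
        _ ≤ starSum T F * (39 * (2 * δ) ^ 2) := by gcongr
        _ = 156 * δ ^ 2 * starSum T F := by ring
    exact_mod_cast h1
  set coeff := (productEquiv hD hT ho hd0 hF).symm with hcoeff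
  -- Both networks use the same blocks and the same `M`. Output `i` of `Φ` selects the blocks of one
  -- shape function; output `k` of `Ψ v` weights those of the factor `k` by the coefficients of `v`.
  let Φ : NeuralNet d (Σ i : Index T F, Fin (F i.1).valDim) :=
    blockNet (fun n => B (cellEquiv T F n)) M fun q => cellWeight T F (Pi.single q.1 1) q.2
  let Ψ : ProductSpace D T F → NeuralNet d (Σ k : Fin m, Fin (F k).valDim) := fun v =>
    blockNet (fun n => B (cellEquiv T F n)) M fun q =>
      cellWeight T F (fun i => if i.1 = q.1 then coeff v i else 0) q.2
  have hΨ : ∀ v : ProductSpace D T F, ∀ᵐ x ∂(volume.restrict D),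
      ∀ (k : Fin m) (c : Fin (F k).valDim), (Ψ v).realize x ⟨k, c⟩ = (v k).1 x c := by
    intro v
    have hv : ∀ᵐ x ∂(volume.restrict D), ∀ k, (v k).1 x =
        ∑ j, coeff v ⟨k, j⟩ • shapeFun T o (F k).kind j.1 x := by
      refine ae_all_iff.2 fun k => ?_
      have := coeFn_productEquiv hD hT ho hd0 hF (coeff v) k
      rwa [hcoeff, LinearEquiv.apply_symm_apply] at this
    filter_upwards [hv, ae_restrict_mem hD.measurableSet] with x hx hxD k c
    refine (realize_blockNet _ _ (hM x hxD) _).trans ?_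
    rw [sum_cellWeight hB _ (c.2.trans_le (hval k)), hx k, Finset.sum_apply, Fintype.sum_sigma,
      Finset.sum_eq_single k]
    · refine Finset.sum_congr rfl fun j _ => ?_
      rw [if_pos rfl, dif_pos c.2]
      rfl
    · intro k' _ hk
      exact Finset.sum_eq_zero fun j _ => by rw [if_neg hk, zero_mul]
    · simp
  -- Equal networks have equal realizations, and these determine the classes modulo equality almost
  -- everywhere.
  have hinj : Function.Injective Ψ := by
    intro v w hvw
    funext k
    refine Subtype.ext (AEEqFun.ext ?_)
    filter_upwards [hΨ v, hΨ w] with x hx hx'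
    funext c
    rw [← hx, ← hx', hvw]
  refine ⟨Φ, Ψ, ?_, rfl, hsize _ ?_, ?_, fun v => ⟨hΨ v, rfl, hsize _ ?_, rfl⟩, ?_⟩
  · filter_upwards [ae_restrict_mem hD.measurableSet] with x hxD i c
    refine (realize_blockNet _ _ (hM x hxD) _).trans ?_
    rw [sum_cellWeight hB _ (c.2.trans_le (hval i.1)), Finset.sum_eq_single i]
    · rw [Pi.single_eq_same, one_mul, dif_pos c.2]
    · intro i' _ hi
      rw [Pi.single_eq_of_ne hi, zero_mul]
    · simp
  · refine size_blockNet_le (r := fun i : Index T F => (F i.1).valDim) (fun i => hval i.1) hd _ _ _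
      (fun n => (cellEquiv T F n).1) fun i c n c' h => ?_
    by_contra hi
    refine h ?_
    simp only [cellWeight, Pi.single_eq_of_ne (Ne.symm hi), ite_self]
  · change (blockLayers _ _).architecture = _
    rw [architecture_blockLayers, ← sum_starData]
  · refine size_blockNet_le (r := fun k : Fin m => (F k).valDim) hval hd _ _ _
      (fun n => (cellEquiv T F n).1.1) fun k c n c' h => ?_
    by_contra hk
    refine h ?_
    simp only [cellWeight, if_neg (Ne.symm hk), ite_self]
  · obtain ⟨i1, i2, R, hR, hR'⟩ := exists_module_range Ψ hinj
    refine ⟨i1, i2, R, hR, ?_⟩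
    rintro ⟨_, v, rfl⟩ k
    filter_upwards [hΨ v] with x hx
    rw [hR' v]
    funext c
    exact (hx k c).symm
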